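/- For $x\in\mathbb{R}$ let $\|x\|$ denote the distance from $x$ to $\mathbb{Z}$. Let $\gamma,\beta$ be irrational numbers such that the pair $(\gamma,\beta)$ is Diophantine, that is, $\gamma,\beta$ are linearly independent over $\mathbb{Q}$ and there are $\rho,c>0$ with $$\|n\gamma+m\beta\|\ge c\,\max\{|n|,|m|\}^{-\rho}\qquad\text{for all } (n,m)\in\mathbb{Z}^2\setminus\{(0,0)\}.$$ Then there is $\omega_0>0$, depending only on $(\gamma,\beta)$, such that for every $\omega\in(0,\omega_0)$, every real number $\gamma'$ and every (not necessarily monotone) function $\psi:\mathbb{N}\to[0,\infty)$ with $\psi(q)=O\big((q\log q\,(\log\log q)^2)^{-1}\big)$ as $q\to\infty$, the following holds. If $$\sum_{\substack{q\ge 1\\ \|q\beta-\gamma'\|\in[q^{-\omega},1)}}\frac{\psi(q)}{\|q\beta-\gamma'\|}=\infty,$$ then the set $$W(\psi,\beta,\gamma,\gamma')=\{x\in[0,1]:\ \|qx-\gamma\|\,\|q\beta-\gamma'\|<\psi(q)\text{ for infinitely many } q\in\mathbb{N}\}$$ has Lebesgue measure $1$. -/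

import Mathlib

open Filter Asymptotics MeasureTheory

/-- `distInt x` is `‖x‖`, the distance from the real number `x` to the set of integers
(`round x` is an integer nearest to `x`). -/
noncomputable def distInt (x : ℝ) : ℝ := |x - round x|

/-- `distInt x` is the distance from `x` to the set of integers. -/
theorem distInt_eq_infDist (x : ℝ) :
    distInt x = Metric.infDist x (Set.range (fun n : ℤ => (n : ℝ))) := by
  apply le_antisymm
  · refine (Metric.le_infDist (Set.range_nonempty _)).2 ?_
    rintro _ ⟨n, rfl⟩
    exact round_le x n
  · exact Metric.infDist_le_dist_of_mem ⟨round x, rfl⟩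

/-- `(γ, β)` is a Diophantine pair: `γ, β` are linearly independent over `ℚ` and there are
`ρ, c > 0` with `‖n γ + m β‖ ≥ c (max (|n|, |m|)) ^ (-ρ)` for all integers `n, m`, not both zero. -/
def IsDiophantinePair (γ β : ℝ) : Prop :=
  LinearIndependent ℚ ![γ, β] ∧
    ∃ ρ c : ℝ, 0 < ρ ∧ 0 < c ∧ ∀ n m : ℤ, (n ≠ 0 ∨ m ≠ 0) →
      c * (max |(n : ℝ)| |(m : ℝ)|) ^ (-ρ) ≤ distInt (n * γ + m * β)

/-- `W(ψ, β, γ, γ')`: the `x ∈ [0, 1]` such that `‖q x - γ‖ ‖q β - γ'‖ < ψ(q)` for infinitely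
many natural numbers `q`. -/
def fibredSet (ψ : ℕ → ℝ) (β γ γ' : ℝ) : Set ℝ :=
  {x | x ∈ Set.Icc (0 : ℝ) 1 ∧
    ∃ᶠ q : ℕ in atTop, distInt (q * x - γ) * distInt (q * β - γ') < ψ q}

/-- The positive integers `q` with `‖q β - γ'‖ ∈ [q ^ (-ω), 1)`. -/
def admissible (β γ' ω : ℝ) : Set ℕ :=
  {q | 1 ≤ q ∧ distInt (q * β - γ') ∈ Set.Ico ((q : ℝ) ^ (-ω)) 1}

/-! Put Ψ(q) = ψ(q)/‖qβ-γ'‖ on the admissible q and E_q = {t ∈ ℝ/ℤ : ‖qt-γ‖ < Ψ(q)}. For Ψ(q) ≤ 1/2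
and q ≥ 1, E_q has measure 2Ψ(q), so the task is to show that almost every t lies in infinitely many
E_q. Write S for a partial sum of the measures. The second-moment criterion
`ae_frequently_mem_of_pairwise` gives full measure directly, without a zero-one law, once the
covariances |E_q ∩ E_r| - |E_q||E_r| (the excess) sum to at most εS² + C_ε S for every ε > 0.
Discarding the q with Ψ(q) < 1/(q log³ q) costs a convergent series, so Ψ also has a lower bound on
its support (`exists_isTruncated`).

Averaging over translations by multiples of 1/q bounds the excess by 2 gcd(q,r)Ψ(q)/q, and likewise
with q and r exchanged. If r > q and rΨ(q) ≥ K gcd(q,r), the excess is at most (2/K)Ψ(q)Ψ(r), which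
goes into εS². The other r > q must contribute O(Ψ(q)) in total (`exists_sum_excess_le`). For r ≥
q^(1+κ) the divisor bound suffices. For smaller r, put d = gcd(q,r) and n = (r-q)/d: if E_q meets
E_r, then nγ is close to an integer. When d ≥ q^κ' this closeness is so strong that the gaps forced
by the Diophantine condition leave few n.

When d is small, r is localised dyadically in size, r ≈ 2^i q, and in ‖rβ-γ'‖ ≈ 2^(-j), and the n
are counted by equidistribution of (nγ, ndβ) (`card_box_le`). Each box contributes O(Ψ(q)/(d log q
(log log q)²)) (`sum_excess_box_le`). The shells j cost log q. Rankin's trick with exponent 1/log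
log q makes the sums over i and over d ∣ q cost log log q each, the latter by
`sum_divisors_rpow_le_loglog`. The product of these costs is exactly the weight in the growth
hypothesis on ψ. -/

theorem distInt_eq_norm (x : ℝ) : distInt x = ‖(x : UnitAddCircle)‖ :=
  UnitAddCircle.norm_eq.symm

theorem distInt_nonneg (x : ℝ) : 0 ≤ distInt x := abs_nonneg _

theorem distInt_le_half (x : ℝ) : distInt x ≤ 1 / 2 := abs_sub_round x

/-! ### Measures and overlaps of the approximation sets. -/

/-- The points `t` of the circle with `‖q t - γ‖ < u`. -/
def approxSet (γ : UnitAddCircle) (q : ℕ) (u : ℝ) : Set UnitAddCircle := {t | ‖q • t - γ‖ < u}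

theorem measurableSet_approxSet (γ : UnitAddCircle) (q : ℕ) (u : ℝ) :
    MeasurableSet (approxSet γ q u) :=
  (isOpen_lt (by fun_prop) continuous_const).measurableSet

/-- Multiplication by q preserves Haar measure, so this is the measure of a ball of radius u; u ≤
1/2 prevents wrapping around the circle. -/
theorem volume_real_approxSet (γ : UnitAddCircle) {q : ℕ} (hq : q ≠ 0) {u : ℝ} (hu : 0 ≤ u)
    (hu' : u ≤ 1 / 2) : volume.real (approxSet γ q u) = 2 * u := by
  have hmp : MeasurePreserving (fun t : UnitAddCircle => (q : ℤ) • t) volume volume :=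
    Measure.measurePreserving_zsmul volume (by exact_mod_cast hq)
  have h1 : approxSet γ q u = (fun t : UnitAddCircle => (q : ℤ) • t) ⁻¹' Metric.ball γ u := by
    ext t
    simp [approxSet, dist_eq_norm]
  rw [h1, hmp.measureReal_preimage Metric.isOpen_ball.measurableSet.nullMeasurableSet]
  have h2 : volume.real (Metric.ball γ u) = volume.real (Metric.closedBall γ u) :=
    measureReal_congr (AddCircle.closedBall_ae_eq_ball).symm
  rw [h2, measureReal_def, AddCircle.volume_closedBall, ENNReal.toReal_ofReal]
  · rw [min_eq_right]; linarith
  · exact le_min zero_le_one (by linarith)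

theorem card_Ioo_int_le {a b : ℝ} (s : Finset ℤ) (hs : ∀ w ∈ s, a < w ∧ (w : ℝ) < b) (hab : a ≤ b) :
    (s.card : ℝ) ≤ b - a + 1 := by
  have h1 : s ⊆ Finset.Ioo ⌊a⌋ ⌈b⌉ := by
    intro w hw
    obtain ⟨h1, h2⟩ := hs w hw
    rw [Finset.mem_Ioo]
    exact ⟨Int.floor_lt.2 h1, Int.lt_ceil.2 h2⟩
  have h2 := Finset.card_le_card h1
  rw [Int.card_Ioo] at h2
  have h3 : (s.card : ℤ) ≤ max (⌈b⌉ - ⌊a⌋ - 1) 0 := by omega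
  have h4 : (s.card : ℝ) ≤ max ((⌈b⌉ : ℝ) - ⌊a⌋ - 1) 0 := by exact_mod_cast h3
  refine h4.trans (max_le ?_ (by linarith))
  have := Int.ceil_lt_add_one b
  have := Int.lt_floor_add_one a
  linarith

theorem card_range_modEq_le (d m : ℕ) (s : Finset ℕ) (hs : ∀ j ∈ s, j < d * m)
    (hc : ∀ i ∈ s, ∀ j ∈ s, i ≡ j [MOD m]) : s.card ≤ d := by
  rw [← Finset.card_range d]
  refine Finset.card_le_card_of_injOn (fun j => j / m) ?_ ?_
  · intro j hj
    have := hs j hj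
    simp only [Finset.coe_range, Set.mem_Iio]
    exact Nat.div_lt_of_lt_mul (by rwa [mul_comm])
  · intro i hi j hj hij
    have h := hc i hi j hj
    simp only at hij
    rw [← Nat.div_add_mod i m, ← Nat.div_add_mod j m, hij, h]

/-- Among the shifts of a point by the multiples `r j / q`, at most `2 q v + gcd(q, r)` are within
`v` of `0`. -/
theorem card_shift_le {q r : ℕ} (hq : 0 < q) (y : ℝ) {v : ℝ} (hv : 0 ≤ v) :
    (((Finset.range q).filter fun j : ℕ => distInt (y + r * j / q) < v).card : ℝ)
      ≤ 2 * q * v + q.gcd r := by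
  classical
  set d := q.gcd r with hd
  have hdpos : 0 < d := Nat.gcd_pos_of_pos_left _ hq
  obtain ⟨q', hq'⟩ : d ∣ q := Nat.gcd_dvd_left q r
  obtain ⟨r', hr'⟩ : d ∣ r := Nat.gcd_dvd_right q r
  have hcop : Nat.Coprime q' r' := by
    have := Nat.coprime_div_gcd_div_gcd (m := q) (n := r) hdpos
    rw [← hd] at this
    rwa [Nat.div_eq_of_eq_mul_right hdpos hq', Nat.div_eq_of_eq_mul_right hdpos hr'] at this
  have hq'pos : 0 < q' := by
    rcases Nat.eq_zero_or_pos q' with h | h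
    · rw [h] at hq'; omega
    · exact h
  have hqR : (q : ℝ) = d * q' := by exact_mod_cast hq'
  have hrR : (r : ℝ) = d * r' := by exact_mod_cast hr'
  have hdR : (0 : ℝ) < d := by exact_mod_cast hdpos
  have hq'R : (0 : ℝ) < q' := by exact_mod_cast hq'pos
  set S := (Finset.range q).filter fun j : ℕ => distInt (y + r * j / q) < v
  -- `f j` equals q' times (the signed remainder of y + rj/q, minus y), so it lies in an interval of
  -- length 2q'v. It also fixes j modulo q', since r' is invertible there, so each value is taken at
  -- most d times.
  let f : ℕ → ℤ := fun j => r' * j - q' * round (y + r * j / q)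
  have hfS : ∀ j ∈ S, q' * (-y - v) < f j ∧ (f j : ℝ) < q' * (-y + v) := by
    intro j hj
    have h := (Finset.mem_filter.1 hj).2
    unfold distInt at h
    have h3 : (r : ℝ) * j / q = r' * j / q' := by
      rw [hqR, hrR]; field_simp
    have h4 : (f j : ℝ) = q' * ((y + r * j / q - round (y + r * j / q)) - y) := by
      simp only [f]; push_cast; rw [show y + r * j / q - round (y + r * j / q) - y
        = r * j / q - round (y + r * j / q) by ring]
      rw [mul_sub]; congr 1; rw [h3]; field_simp
    rw [abs_lt] at h
    rw [h4]
    constructor <;> apply mul_lt_mul_of_pos_left _ hq'R <;> linarith [h.1, h.2]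
  have h1 : S.card ≤ (S.image f).card * d := by
    rw [mul_comm]
    refine Finset.card_le_mul_card_image S d ?_
    intro w hw
    refine card_range_modEq_le d q' _ ?_ ?_
    · intro j hj
      have := Finset.mem_range.1 (Finset.mem_filter.1 (Finset.mem_filter.1 hj).1).1
      omega
    · intro i hi j hj
      have hi2 := (Finset.mem_filter.1 hi).2
      have hj2 := (Finset.mem_filter.1 hj).2
      have h5 : (r' * i : ℕ) ≡ r' * j [MOD q'] := by
        rw [← Int.natCast_modEq_iff, Int.modEq_iff_dvd]
        simp only [f] at hi2 hj2
        refine ⟨round (y + r * j / q) - round (y + r * i / q), ?_⟩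
        push_cast
        linear_combination hj2 - hi2
      exact Nat.ModEq.cancel_left_of_coprime hcop h5
  have h2 := card_Ioo_int_le (a := q' * (-y - v)) (b := q' * (-y + v)) (S.image f)
    (by
      intro w hw
      obtain ⟨j, hj, rfl⟩ := Finset.mem_image.1 hw
      exact hfS j hj) (by nlinarith)
  calc (S.card : ℝ) ≤ (S.image f).card * d := by exact_mod_cast h1
    _ ≤ (q' * (-y + v) - q' * (-y - v) + 1) * d := by gcongr
    _ = 2 * q * v + d := by rw [hqR]; ring

/-- The set for q is invariant under translation by j/q. Averaging the indicator of the other set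
over these q translations and applying `card_shift_le` pointwise bounds q times the overlap by (2qv
+ gcd) · 2u. -/
theorem volume_real_approxSet_inter_le (γ : UnitAddCircle) {q r : ℕ} (hq : 0 < q)
    {u v : ℝ} (hu : 0 ≤ u) (hu' : u ≤ 1 / 2) (hv : 0 ≤ v) :
    volume.real (approxSet γ q u ∩ approxSet γ r v) ≤ 4 * u * v + 2 * q.gcd r * u / q := by
  classical
  have hqR : (0 : ℝ) < q := by exact_mod_cast hq
  let s : ℕ → UnitAddCircle := fun j => ((j / q : ℝ) : UnitAddCircle)
  have hs : ∀ j, q • s j = 0 := by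
    intro j
    simp only [s]
    rw [← AddCircle.coe_nsmul, nsmul_eq_mul, mul_div_cancel₀ _ hqR.ne']
    rw [AddCircle.coe_eq_zero_iff]
    exact ⟨j, by simp⟩
  have h1 : ∀ j, volume.real (approxSet γ q u ∩ approxSet γ r v) =
      ∫ t in approxSet γ q u, (approxSet γ r v).indicator (fun _ => (1 : ℝ)) (t + s j) := by
    intro j
    have hmp := measurePreserving_add_right (volume : Measure UnitAddCircle) (s j)
    rw [← hmp.measureReal_preimage ((measurableSet_approxSet γ q u).inter
      (measurableSet_approxSet γ r v)).nullMeasurableSet]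
    have h2 : (fun x => x + s j) ⁻¹' (approxSet γ q u ∩ approxSet γ r v) =
        approxSet γ q u ∩ (fun x => x + s j) ⁻¹' approxSet γ r v := by
      ext t
      simp [approxSet, smul_add, hs]
    rw [h2]
    have h3 : (fun t => (approxSet γ r v).indicator (fun _ => (1 : ℝ)) (t + s j)) =
        ((fun x => x + s j) ⁻¹' approxSet γ r v).indicator (fun _ => (1 : ℝ)) := by
      ext t; simp [Set.indicator]
    have hm : MeasurableSet ((fun x => x + s j) ⁻¹' approxSet γ r v) :=
      hmp.measurable (measurableSet_approxSet γ r v)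
    rw [h3, integral_indicator hm]
    simp [Measure.real, Measure.restrict_apply MeasurableSet.univ, Measure.restrict_restrict hm, Set.inter_comm]
  have hint : ∀ j, Integrable (fun t => (approxSet γ r v).indicator (fun _ => (1 : ℝ)) (t + s j))
      (volume.restrict (approxSet γ q u)) := by
    intro j
    refine Integrable.of_bound (C := 1) ?_ ?_
    · exact ((measurable_const.indicator (measurableSet_approxSet γ r v)).comp
        (measurable_add_const (s j))).aestronglyMeasurable
    · refine Eventually.of_forall fun t => ?_
      by_cases h : t + s j ∈ approxSet γ r v <;> simp [h]
  have h2 : q * volume.real (approxSet γ q u ∩ approxSet γ r v) =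
      ∫ t in approxSet γ q u, ∑ j ∈ Finset.range q,
        (approxSet γ r v).indicator (fun _ => (1 : ℝ)) (t + s j) := by
    rw [integral_finsetSum _ fun j _ => hint j, Finset.sum_congr rfl fun j _ => (h1 j).symm]
    simp
  have h3 : ∀ t : UnitAddCircle, ∑ j ∈ Finset.range q,
        (approxSet γ r v).indicator (fun _ => (1 : ℝ)) (t + s j) ≤ 2 * q * v + q.gcd r := by
    intro t
    obtain ⟨y, hy⟩ : ∃ y : ℝ, (y : UnitAddCircle) = r • t - γ := QuotientAddGroup.mk_surjective _
    have h5 := card_shift_le (r := r) hq y hv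
    refine le_trans (le_of_eq ?_) h5
    rw [Finset.card_filter]
    push_cast
    refine Finset.sum_congr rfl fun j _ => ?_
    have h6 : ((y + r * j / q : ℝ) : UnitAddCircle) = r • (t + s j) - γ := by
      rw [AddCircle.coe_add, hy, smul_add]
      simp only [s]
      rw [← AddCircle.coe_nsmul, nsmul_eq_mul, mul_div_assoc]
      abel
    rw [distInt_eq_norm, h6]
    simp [Set.indicator, approxSet]
  have h4 : q * volume.real (approxSet γ q u ∩ approxSet γ r v) ≤
      (2 * q * v + q.gcd r) * (2 * u) := by
    rw [h2, ← volume_real_approxSet γ hq.ne' hu hu']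
    calc _ ≤ ∫ t in approxSet γ q u, ((2 * q * v + q.gcd r : ℝ)) := by
          refine integral_mono (integrable_finsetSum _ fun j _ => hint j) (integrable_const _) h3
      _ = _ := by simp [mul_comm]
  have h5 : volume.real (approxSet γ q u ∩ approxSet γ r v) ≤
      (2 * q * v + q.gcd r) * (2 * u) / q := by
    rw [le_div_iff₀ hqR, mul_comm]; exact h4
  refine h5.trans (le_of_eq ?_)
  field_simp
  ring

/-- If the sets for `q = d q'` and `r = d (q' + n)` meet, then `n γ` is close to an integer. -/
theorem norm_nsmul_lt_of_mem_inter {γ : UnitAddCircle} {d q' n : ℕ} {u v : ℝ} (hq' : 0 < q')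
    {t : UnitAddCircle} (h1 : t ∈ approxSet γ (d * q') u)
    (h2 : t ∈ approxSet γ (d * (q' + n)) v) :
    ‖n • γ‖ < (q' + n : ℕ) * u + q' * v := by
  -- In this combination of rt - γ and qt - γ the multiples of t cancel, leaving only γ.
  have h3 : n • γ = q' • ((d * (q' + n)) • t - γ) - (q' + n) • ((d * q') • t - γ) := by
    rw [smul_sub, smul_sub, smul_smul, smul_smul, add_smul q' n γ,
      show q' * (d * (q' + n)) = (q' + n) * (d * q') by ring]
    abel
  rw [h3]
  have h4 : ‖q' • ((d * (q' + n)) • t - γ)‖ ≤ q' * ‖(d * (q' + n)) • t - γ‖ := norm_nsmul_le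
  have h5 : ‖(q' + n) • ((d * q') • t - γ)‖ ≤ (q' + n : ℕ) * ‖(d * q') • t - γ‖ := norm_nsmul_le
  have h6 : (q' : ℝ) * ‖(d * (q' + n)) • t - γ‖ ≤ q' * v :=
    mul_le_mul_of_nonneg_left (le_of_lt h2) (by positivity)
  have h7 : ((q' + n : ℕ) : ℝ) * ‖(d * q') • t - γ‖ < (q' + n : ℕ) * u :=
    mul_lt_mul_of_pos_left h1 (by positivity)
  have := norm_sub_le (q' • ((d * (q' + n)) • t - γ)) ((q' + n) • ((d * q') • t - γ))
  linarith

/-! ### A second-moment criterion for full measure. -/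

section SecondMoment

variable {Ω : Type*} [MeasurableSpace Ω] (μ : Measure Ω) [IsProbabilityMeasure μ]

theorem integral_sq_sum_indicator_sub (A : ℕ → Set Ω) (hA : ∀ n, MeasurableSet (A n))
    (s : Finset ℕ) :
    ∫ x, (∑ n ∈ s, ((A n).indicator (fun _ => (1 : ℝ)) x - μ.real (A n))) ^ 2 ∂μ =
      ∑ m ∈ s, ∑ n ∈ s, (μ.real (A m ∩ A n) - μ.real (A m) * μ.real (A n)) := by
  have hi : ∀ m n, Integrable (fun x => ((A m).indicator (fun _ => (1 : ℝ)) x - μ.real (A m)) *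
      ((A n).indicator (fun _ => (1 : ℝ)) x - μ.real (A n))) μ := by
    intro m n
    refine Integrable.of_bound (C := 1) ?_ ?_
    · exact (((measurable_const.indicator (hA m)).sub_const _).mul
        ((measurable_const.indicator (hA n)).sub_const _)).aestronglyMeasurable
    · have key : ∀ k x, |(A k).indicator (fun _ => (1 : ℝ)) x - μ.real (A k)| ≤ 1 := by
        intro k x
        have h1 : μ.real (A k) ≤ 1 := measureReal_le_one
        have h0 : 0 ≤ μ.real (A k) := measureReal_nonneg
        by_cases h : x ∈ A k <;> simp [h, abs_le] <;> linarith
      refine Eventually.of_forall fun x => ?_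
      rw [Real.norm_eq_abs, abs_mul]
      exact mul_le_one₀ (key m x) (abs_nonneg _) (key n x)
  simp_rw [sq, Finset.sum_mul_sum]
  rw [integral_finsetSum _ fun m _ => integrable_finsetSum _ fun n _ => hi m n]
  refine Finset.sum_congr rfl fun m _ => ?_
  rw [integral_finsetSum _ fun n _ => hi m n]
  refine Finset.sum_congr rfl fun n _ => ?_
  have hm : Integrable ((A m).indicator fun _ => (1 : ℝ)) μ := (integrable_const 1).indicator (hA m)
  have hn : Integrable ((A n).indicator fun _ => (1 : ℝ)) μ := (integrable_const 1).indicator (hA n)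
  have hmn : Integrable ((A m ∩ A n).indicator fun _ => (1 : ℝ)) μ :=
    (integrable_const 1).indicator ((hA m).inter (hA n))
  have h1 : ∀ x, ((A m).indicator (fun _ => (1 : ℝ)) x - μ.real (A m)) *
      ((A n).indicator (fun _ => (1 : ℝ)) x - μ.real (A n)) =
      (A m ∩ A n).indicator (fun _ => (1 : ℝ)) x - (μ.real (A n) * (A m).indicator (fun _ => (1 : ℝ)) x +
      μ.real (A m) * (A n).indicator (fun _ => (1 : ℝ)) x) + μ.real (A m) * μ.real (A n) := by
    intro x
    by_cases h : x ∈ A m <;> by_cases h' : x ∈ A n <;> simp [h, h'] <;> ring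
  simp_rw [h1]
  rw [integral_add, integral_sub, integral_add, integral_const_mul, integral_const_mul,
    integral_indicator (hA m), integral_indicator (hA n), integral_indicator ((hA m).inter (hA n))]
  · simp [Measure.real]; ring
  · exact hm.const_mul _
  · exact hn.const_mul _
  · exact hmn
  · exact (hm.const_mul _).add (hn.const_mul _)
  · exact hmn.sub ((hm.const_mul _).add (hn.const_mul _))
  · exact integrable_const _

/-- A second-moment converse of the Borel–Cantelli lemma. -/
theorem ae_frequently_mem_of_pairwise (A : ℕ → Set Ω) (hA : ∀ n, MeasurableSet (A n))
    (hdiv : Tendsto (fun N => ∑ n ∈ Finset.range N, μ.real (A n)) atTop atTop)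
    (hpair : ∀ ε > 0, ∃ C : ℝ, ∀ N, ∑ m ∈ Finset.range N, ∑ n ∈ Finset.range N,
      (μ.real (A m ∩ A n) - μ.real (A m) * μ.real (A n)) ≤
        ε * (∑ n ∈ Finset.range N, μ.real (A n)) ^ 2 + C * ∑ n ∈ Finset.range N, μ.real (A n)) :
    ∀ᵐ x ∂μ, ∃ᶠ n in atTop, x ∈ A n := by
  let X : ℕ → Ω → ℝ := fun N x => ∑ n ∈ Finset.range N, (A n).indicator (fun _ => (1 : ℝ)) x
  let S : ℕ → ℝ := fun N => ∑ n ∈ Finset.range N, μ.real (A n)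
  have hbd : ∀ M : ℕ, μ {x | ∀ N, X N x ≤ M} = 0 := by
    intro M
    have hreal : ∀ ε > 0, μ.real {x | ∀ N, X N x ≤ M} ≤ ε := by
      intro ε hε
      obtain ⟨C, hC⟩ := hpair (ε / 8) (by positivity)
      -- S ≥ 2M turns X ≤ M into |X - S| ≥ S/2, and S ≥ 8|C|/ε absorbs CS into (ε/8)S². Chebyshev
      -- then gives (ε/8 + ε/8)S² / (S/2)² = ε.
      have hlarge : ∀ᶠ N in atTop, 2 * (M : ℝ) + 8 * |C| / ε + 1 ≤ S N := hdiv.eventually_ge_atTop _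
      obtain ⟨N, hN⟩ := hlarge.exists
      have hM : (0 : ℝ) ≤ M := Nat.cast_nonneg M
      have hCε : 0 ≤ 8 * |C| / ε := by positivity
      have h1 : μ.real {x | ∀ N, X N x ≤ M} ≤ μ.real {x | (S N / 2) ^ 2 ≤
          (∑ n ∈ Finset.range N, ((A n).indicator (fun _ => (1 : ℝ)) x - μ.real (A n))) ^ 2} := by
        refine measureReal_mono ?_
        intro x hx
        have h2 : X N x ≤ M := hx N
        simp only [Set.mem_ofPred_eq, Finset.sum_sub_distrib]
        change (S N / 2) ^ 2 ≤ (X N x - S N) ^ 2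
        nlinarith
      have hint : Integrable (fun x =>
          (∑ n ∈ Finset.range N, ((A n).indicator (fun _ => (1 : ℝ)) x - μ.real (A n))) ^ 2) μ := by
        have hmeas : Measurable fun x =>
            ∑ n ∈ Finset.range N, ((A n).indicator (fun _ => (1 : ℝ)) x - μ.real (A n)) :=
          Finset.measurable_sum _ fun n _ => (measurable_const.indicator (hA n)).sub_const _
        refine Integrable.of_bound (C := (N : ℝ) ^ 2) (hmeas.pow_const 2).aestronglyMeasurable ?_
        refine Eventually.of_forall fun x => ?_
        rw [norm_pow]
        gcongr
        refine (norm_sum_le _ _).trans ?_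
        have key : ∀ k, ‖(A k).indicator (fun _ => (1 : ℝ)) x - μ.real (A k)‖ ≤ 1 := by
          intro k
          have h1 : μ.real (A k) ≤ 1 := measureReal_le_one
          have h0 : 0 ≤ μ.real (A k) := measureReal_nonneg
          rw [Real.norm_eq_abs]
          by_cases h : x ∈ A k <;> simp [h, abs_le] <;> linarith
        exact (Finset.sum_le_sum fun k _ => key k).trans (by simp)
      have h3 := mul_meas_ge_le_integral_of_nonneg (μ := μ)
        (f := fun x => (∑ n ∈ Finset.range N,
          ((A n).indicator (fun _ => (1 : ℝ)) x - μ.real (A n))) ^ 2)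
        (Eventually.of_forall fun x => sq_nonneg _) hint ((S N / 2) ^ 2)
      rw [integral_sq_sum_indicator_sub μ A hA] at h3
      have h4 := h3.trans (hC N)
      change _ ≤ ε / 8 * S N ^ 2 + C * S N at h4
      have hS : 0 < S N := by linarith
      have h5 : C * S N ≤ ε / 8 * S N ^ 2 := by
        have h6 : 8 * |C| / ε ≤ S N := by linarith
        rw [div_le_iff₀ hε] at h6
        have := le_abs_self C
        nlinarith
      have h7 : (S N / 2) ^ 2 * μ.real {x | ∀ N, X N x ≤ M} ≤ (S N / 2) ^ 2 * ε := by
        refine (mul_le_mul_of_nonneg_left h1 (sq_nonneg _)).trans ?_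
        refine h4.trans ?_
        nlinarith
      exact le_of_mul_le_mul_left h7 (by positivity)
    have h0 : μ.real {x | ∀ N, X N x ≤ M} = 0 :=
      le_antisymm (le_of_forall_pos_le_add fun ε hε => by simpa using hreal ε hε) measureReal_nonneg
    exact (measureReal_eq_zero_iff).1 h0
  have hall : ∀ᵐ x ∂μ, ∀ M : ℕ, ¬ ∀ N, X N x ≤ M := by
    rw [ae_all_iff]
    intro M
    rw [ae_iff]
    simpa using hbd M
  filter_upwards [hall] with x hx
  by_contra hcon
  rw [not_frequently, eventually_atTop] at hcon
  obtain ⟨M, hM⟩ := hcon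
  refine hx M fun N => ?_
  have h1 : X N x ≤ ∑ n ∈ Finset.range M, (1 : ℝ) := by
    have h2 : X N x = ∑ n ∈ (Finset.range N).filter (· < M), (A n).indicator (fun _ => (1 : ℝ)) x := by
      simp only [X]
      rw [Finset.sum_filter]
      refine Finset.sum_congr rfl fun n _ => ?_
      by_cases h : n < M
      · simp [h]
      · simp [h, hM n (not_lt.1 h)]
    rw [h2]
    refine (Finset.sum_le_sum (g := fun _ => (1 : ℝ)) fun n _ => ?_).trans ?_
    · exact Set.indicator_le_self' (fun _ _ => zero_le_one) x
    · refine Finset.sum_le_sum_of_subset_of_nonneg ?_ fun _ _ _ => zero_le_one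
      intro n hn
      simp only [Finset.mem_filter] at hn
      exact Finset.mem_range.2 hn.2
  simpa using h1

end SecondMoment

/-! ### Divisor sums, Euler products and a Mertens bound. -/

section Divisors

/-- The quotient of the divisor count by n^ε is a product of (a+1)/p^(εa) over the prime powers p^a
exactly dividing n. For p ≥ P one has p^ε ≥ 2, so the factor is at most 1; each of the fewer than P
smaller primes costs at most C₀, because a + 1 ≤ C₀(1 + aε log 2). -/
theorem card_divisors_le_rpow {ε : ℝ} (hε : 0 < ε) :
    ∃ C : ℝ, 0 < C ∧ ∀ n : ℕ, n ≠ 0 → (n.divisors.card : ℝ) ≤ C * (n : ℝ) ^ ε := by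
  set C₀ : ℝ := max 1 (1 / (ε * Real.log 2)) with hC₀
  have hl2 : 0 < Real.log 2 := Real.log_pos one_lt_two
  have hC1 : 1 ≤ C₀ := le_max_left _ _
  obtain ⟨P, hP⟩ := exists_nat_ge ((2 : ℝ) ^ (1 / ε))
  refine ⟨C₀ ^ P, by positivity, fun n hn => ?_⟩
  have hn' : (n : ℝ) ^ ε = ∏ p ∈ n.primeFactors, ((p : ℝ) ^ ε) ^ n.factorization p := by
    have h1 := Nat.prod_factorization_pow_eq_self hn
    conv_lhs => rw [← h1]
    rw [Finsupp.prod, Nat.support_factorization]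
    push_cast
    rw [← Real.finsetProd_rpow _ _ fun p _ => by positivity]
    refine Finset.prod_congr rfl fun p _ => ?_
    rw [← Real.rpow_natCast, ← Real.rpow_natCast, ← Real.rpow_mul (by positivity),
      ← Real.rpow_mul (by positivity), mul_comm]
  have hterm : ∀ p ∈ n.primeFactors, ((n.factorization p + 1 : ℕ) : ℝ) ≤
      (if p < P then C₀ else 1) * ((p : ℝ) ^ ε) ^ n.factorization p := by
    intro p hp
    have hp2 : 2 ≤ p := (Nat.prime_of_mem_primeFactors hp).two_le
    have hp2' : (2 : ℝ) ≤ p := by exact_mod_cast hp2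
    set a := n.factorization p
    push_cast
    split_ifs with h
    · have h1 : 1 + (a : ℝ) * (ε * Real.log 2) ≤ ((p : ℝ) ^ ε) ^ a := by
        calc 1 + (a : ℝ) * (ε * Real.log 2) ≤ Real.exp ((a : ℝ) * (ε * Real.log 2)) := by
              linarith [Real.add_one_le_exp ((a : ℝ) * (ε * Real.log 2))]
          _ = ((2 : ℝ) ^ ε) ^ a := by
              rw [Real.exp_nat_mul, Real.rpow_def_of_pos two_pos, mul_comm ε]
          _ ≤ _ := by gcongr
      have h2 : 1 ≤ C₀ * (ε * Real.log 2) := by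
        have := le_max_right 1 (1 / (ε * Real.log 2))
        rwa [← hC₀, div_le_iff₀ (by positivity)] at this
      calc (a : ℝ) + 1 ≤ C₀ * (1 + (a : ℝ) * (ε * Real.log 2)) := by
            have : (0 : ℝ) ≤ a := by positivity
            nlinarith
        _ ≤ _ := by gcongr
    · rw [one_mul]
      have h1 : (2 : ℝ) ≤ (p : ℝ) ^ ε := by
        have : (2 : ℝ) ^ (1 / ε) ≤ p := hP.trans (by exact_mod_cast not_lt.1 h)
        calc (2 : ℝ) = ((2 : ℝ) ^ (1 / ε)) ^ ε := by
              rw [← Real.rpow_mul (by norm_num), one_div_mul_cancel hε.ne', Real.rpow_one]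
          _ ≤ _ := by gcongr
      have h2 : a + 1 ≤ 2 ^ a := Nat.lt_two_pow_self
      calc (a : ℝ) + 1 ≤ (2 : ℝ) ^ a := by exact_mod_cast h2
        _ ≤ _ := by gcongr
  rw [Nat.card_divisors hn, hn']
  push_cast
  calc _ ≤ ∏ p ∈ n.primeFactors, (if p < P then C₀ else 1) * ((p : ℝ) ^ ε) ^ n.factorization p := by
        refine Finset.prod_le_prod (fun p _ => by positivity) fun p hp => ?_
        exact_mod_cast hterm p hp
    _ = (∏ p ∈ n.primeFactors, (if p < P then C₀ else 1)) *
        ∏ p ∈ n.primeFactors, ((p : ℝ) ^ ε) ^ n.factorization p := Finset.prod_mul_distrib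
    _ ≤ _ := by
      gcongr
      rw [← Finset.prod_filter, Finset.prod_const]
      refine pow_le_pow_right₀ hC1 ?_
      calc _ ≤ (Finset.range P).card := Finset.card_le_card fun p hp =>
            Finset.mem_range.2 (Finset.mem_filter.1 hp).2
        _ = P := Finset.card_range P

/-- The completely multiplicative function `m ↦ m ^ (-s)`. -/
noncomputable def natRpowNegHom (s : ℝ) : ℕ →* ℝ where
  toFun m := (m : ℝ) ^ (-s)
  map_one' := by simp
  map_mul' a b := by push_cast; exact Real.mul_rpow (by positivity) (by positivity)

theorem natRpowNegHom_norm_lt_one {s : ℝ} (hs : 0 < s) {p : ℕ} (hp : p.Prime) :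
    ‖natRpowNegHom s p‖ < 1 := by
  change ‖(p : ℝ) ^ (-s)‖ < 1
  rw [Real.norm_of_nonneg (by positivity)]
  exact Real.rpow_lt_one_of_one_lt_of_neg (by exact_mod_cast hp.one_lt) (by linarith)

/-- The Euler product expands into the sum over all integers composed of the primes of n, and the
divisors of n are among them. -/
theorem sum_divisors_rpow_neg_le {s : ℝ} (hs : 0 < s) {n : ℕ} (hn : n ≠ 0) :
    ∑ d ∈ n.divisors, (d : ℝ) ^ (-s) ≤ ∏ p ∈ n.primeFactors, (1 - (p : ℝ) ^ (-s))⁻¹ := by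
  have h := (EulerProduct.summable_and_hasSum_factoredNumbers_prod_filter_prime_geometric
    (f := natRpowNegHom s) (fun hp => natRpowNegHom_norm_lt_one hs hp) n.primeFactors).2
  have h1 : n.primeFactors.filter Nat.Prime = n.primeFactors :=
    Finset.filter_true_of_mem fun p hp => Nat.prime_of_mem_primeFactors hp
  rw [h1] at h
  have h2 : ∀ d ∈ n.divisors, d ∈ Nat.factoredNumbers n.primeFactors := by
    intro d hd
    have hd' := Nat.dvd_of_mem_divisors hd
    exact Nat.mem_factoredNumbers_of_primeFactors_subset (ne_zero_of_dvd_ne_zero hn hd')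
      (Nat.primeFactors_mono hd' hn)
  classical
  have h3 := sum_le_hasSum (n.divisors.subtype (· ∈ Nat.factoredNumbers n.primeFactors))
    (fun m _ => by change (0 : ℝ) ≤ (m : ℝ) ^ (-s); positivity) h
  refine le_trans (le_of_eq ?_) h3
  rw [Finset.sum_subtype_eq_sum_filter, Finset.filter_true_of_mem h2]
  rfl

/-- An integral comparison carried out by telescoping (m+1)^(-ε) - (m+2)^(-ε); the isolated 1 is the
first term. -/
theorem sum_range_rpow_le {ε : ℝ} (hε : 0 < ε) (N : ℕ) :
    ∑ m ∈ Finset.range N, ((m + 1 : ℕ) : ℝ) ^ (-(1 + ε)) ≤ 1 + 1 / ε := by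
  have hstep : ∀ m : ℕ, ε * ((m + 2 : ℕ) : ℝ) ^ (-(1 + ε)) ≤
      ((m + 1 : ℕ) : ℝ) ^ (-ε) - ((m + 2 : ℕ) : ℝ) ^ (-ε) := by
    intro m
    have h0 : (0 : ℝ) < (m + 2 : ℕ) := by positivity
    have h1 : ((m + 1 : ℕ) : ℝ) = (m + 2 : ℕ) * (1 - 1 / (m + 2 : ℕ)) := by
      field_simp; push_cast; ring
    have hx : (0 : ℝ) < 1 - 1 / (m + 2 : ℕ) := by
      have : (1 : ℝ) / (m + 2 : ℕ) < 1 := by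
        rw [div_lt_one h0]; push_cast; have : (0 : ℝ) ≤ m := by positivity
        linarith
      linarith
    have h2 : 1 + ε / (m + 2 : ℕ) ≤ (1 - 1 / ((m + 2 : ℕ) : ℝ)) ^ (-ε) := by
      rw [Real.rpow_def_of_pos hx]
      have h3 := Real.log_le_sub_one_of_pos hx
      have h4 : ε / (m + 2 : ℕ) ≤ Real.log (1 - 1 / ((m + 2 : ℕ) : ℝ)) * -ε := by
        have : Real.log (1 - 1 / ((m + 2 : ℕ) : ℝ)) ≤ -(1 / ((m + 2 : ℕ) : ℝ)) := by linarith
        calc ε / (m + 2 : ℕ) = -(1 / ((m + 2 : ℕ) : ℝ)) * -ε := by ring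
          _ ≤ _ := mul_le_mul_of_nonpos_right this (by linarith)
      linarith [Real.add_one_le_exp (Real.log (1 - 1 / ((m + 2 : ℕ) : ℝ)) * -ε)]
    rw [h1, Real.mul_rpow h0.le hx.le]
    have h5 : ((m + 2 : ℕ) : ℝ) ^ (-(1 + ε)) = ((m + 2 : ℕ) : ℝ) ^ (-ε) / (m + 2 : ℕ) := by
      rw [show -(1 + ε) = -ε - 1 by ring, Real.rpow_sub_one h0.ne']
    rw [h5]
    have h6 : (0 : ℝ) ≤ ((m + 2 : ℕ) : ℝ) ^ (-ε) := by positivity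
    calc ε * (((m + 2 : ℕ) : ℝ) ^ (-ε) / (m + 2 : ℕ))
        = ((m + 2 : ℕ) : ℝ) ^ (-ε) * (1 + ε / (m + 2 : ℕ)) - ((m + 2 : ℕ) : ℝ) ^ (-ε) := by ring
      _ ≤ _ := by gcongr
  have hmain : ∀ N : ℕ, ε * ∑ m ∈ Finset.range N, ((m + 2 : ℕ) : ℝ) ^ (-(1 + ε)) ≤
      1 - ((N + 1 : ℕ) : ℝ) ^ (-ε) := by
    intro N
    induction N with
    | zero => simp
    | succ N ih =>
      rw [Finset.sum_range_succ, mul_add]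
      have := hstep N
      linarith
  rcases N with _ | N
  · simp; positivity
  · rw [Finset.sum_range_succ']
    have h1 := hmain N
    have h2 : (0 : ℝ) ≤ ((N + 1 : ℕ) : ℝ) ^ (-ε) := by positivity
    have h3 : ∑ m ∈ Finset.range N, ((m + 2 : ℕ) : ℝ) ^ (-(1 + ε)) ≤ 1 / ε := by
      rw [le_div_iff₀ hε, mul_comm]; linarith
    simp only [zero_add, Nat.cast_one, Real.one_rpow]
    linarith

theorem prod_primesBelow_rpow_le {ε : ℝ} (hε : 0 < ε) (N : ℕ) :
    ∏ p ∈ N.primesBelow, (1 - (p : ℝ) ^ (-(1 + ε)))⁻¹ ≤ 1 + 1 / ε := by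
  have h := (EulerProduct.summable_and_hasSum_smoothNumbers_prod_primesBelow_geometric
    (f := natRpowNegHom (1 + ε)) (fun hp => natRpowNegHom_norm_lt_one (by linarith) hp) N).2
  refine hasSum_le_of_sum_le h fun t => ?_
  obtain ⟨M, hM⟩ := (t.map (Function.Embedding.subtype _)).exists_nat_subset_range
  have h1 : ∑ m ∈ t, natRpowNegHom (1 + ε) m =
      ∑ m ∈ t.map (Function.Embedding.subtype _), (m : ℝ) ^ (-(1 + ε)) := by
    rw [Finset.sum_map]; rfl
  rw [h1]
  calc _ ≤ ∑ m ∈ Finset.range (M + 1), (m : ℝ) ^ (-(1 + ε)) := by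
        refine Finset.sum_le_sum_of_subset_of_nonneg (hM.trans ?_) fun _ _ _ => by positivity
        exact Finset.range_subset_range.2 (Nat.le_succ M)
    _ = ∑ m ∈ Finset.range M, ((m + 1 : ℕ) : ℝ) ^ (-(1 + ε)) := by
        rw [Finset.sum_range_succ', Nat.cast_zero, Real.zero_rpow (by linarith), add_zero]
    _ ≤ _ := sum_range_rpow_le hε M

/-- The upper bound in Mertens' first theorem. -/
theorem sum_primesLE_log_div_le {n : ℕ} (hn : 1 ≤ n) :
    ∑ p ∈ Nat.primesLE n, Real.log p / p ≤ Real.log n + Real.log 4 := by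
  have hn0 : (0 : ℝ) < n := by exact_mod_cast hn
  have hmem : ∀ p ∈ Nat.primesLE n, p.Prime ∧ p ≤ n := by
    intro p hp; rw [Nat.mem_primesLE] at hp; exact hp.symm
  -- The exponent of p in n! is at least ⌊n/p⌋. Replacing ⌊n/p⌋ by n/p costs θ(n) ≤ n log 4, which
  -- is the source of the second term of the bound.
  have h1 : ∑ p ∈ Nat.primesLE n, ((n / p : ℕ) : ℝ) * Real.log p ≤ Real.log (n.factorial) := by
    rw [Real.log_nat_eq_sum_factorization, Finsupp.sum]
    have hsub : Nat.primesLE n ⊆ (n.factorial).factorization.support := by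
      intro p hp
      obtain ⟨hp1, hp2⟩ := hmem p hp
      rw [Nat.support_factorization, Nat.mem_primeFactors]
      exact ⟨hp1, (hp1.dvd_factorial).2 hp2, n.factorial_ne_zero⟩
    refine le_trans (Finset.sum_le_sum fun p hp => ?_)
      (Finset.sum_le_sum_of_subset_of_nonneg hsub fun p _ _ => by positivity)
    obtain ⟨hp1, hp2⟩ := hmem p hp
    gcongr
    have h2 := Nat.factorization_factorial_mul (n := n / p) hp1
    have h3 : (p * (n / p)).factorial ∣ n.factorial := Nat.factorial_dvd_factorial (Nat.mul_div_le n p)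
    have h4 := (Nat.factorization_le_iff_dvd (Nat.factorial_ne_zero _) (Nat.factorial_ne_zero _)).2 h3 p
    omega
  have h2 : Real.log (n.factorial) ≤ n * Real.log n := by
    rw [← Real.log_pow]
    exact Real.log_le_log (by exact_mod_cast n.factorial_pos) (by exact_mod_cast n.factorial_le_pow)
  have h3 := Chebyshev.theta_le_log4_mul_x (x := n) (by positivity)
  rw [Chebyshev.theta_eq_sum_primesLE_log] at h3
  have h4 : ∑ p ∈ Nat.primesLE n, (n : ℝ) * (Real.log p / p) ≤
      ∑ p ∈ Nat.primesLE n, (((n / p : ℕ) : ℝ) * Real.log p + Real.log p) := by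
    refine Finset.sum_le_sum fun p hp => ?_
    have h5 : (n : ℝ) / p ≤ (n / p : ℕ) + 1 := by
      have := Nat.lt_floor_add_one ((n : ℝ) / p)
      rw [Nat.floor_div_eq_div] at this
      exact this.le
    have h6 : 0 ≤ Real.log p := Real.log_natCast_nonneg p
    calc (n : ℝ) * (Real.log p / p) = n / p * Real.log p := by ring
      _ ≤ ((n / p : ℕ) + 1) * Real.log p := by gcongr
      _ = _ := by ring
  rw [← Finset.mul_sum, Finset.sum_add_distrib] at h4
  have h7 : (n : ℝ) * ∑ p ∈ Nat.primesLE n, Real.log p / p ≤ n * (Real.log n + Real.log 4) := by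
    linarith
  exact le_of_mul_le_mul_left h7 hn0

end Divisors

/-! ### Grönwall's bound for a divisor sum with exponent near -1. -/

section Gronwall

/-- This moves an Euler factor across the line s = 1, to the side where the product converges. With
x = ε log p ≤ 1, the difference of the two powers is (exp x - exp (-x))/p ≤ 2ex/p, and 1 - b ≥ 1/4
turns it into the exponent 8ex/p. -/
theorem inv_one_sub_rpow_le {ε : ℝ} (hε : 0 < ε) (hε' : ε ≤ 1 / 2) {p : ℕ} (hp : 2 ≤ p)
    (hpε : ε * Real.log p ≤ 1) :
    (1 - (p : ℝ) ^ (-(1 - ε)))⁻¹ ≤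
      (1 - (p : ℝ) ^ (-(1 + ε)))⁻¹ * Real.exp (8 * Real.exp 1 * (ε * (Real.log p / p))) := by
  have hp2 : (2 : ℝ) ≤ p := by exact_mod_cast hp
  have hp0 : (0 : ℝ) < p := by linarith
  set x := ε * Real.log p with hx
  have hx0 : 0 ≤ x := mul_nonneg hε.le (Real.log_natCast_nonneg p)
  set b := (p : ℝ) ^ (-(1 - ε)) with hb
  set a := (p : ℝ) ^ (-(1 + ε)) with ha
  have hb' : b ≤ 3 / 4 := by
    have h1 : b ≤ (2 : ℝ) ^ (-(1 / 2) : ℝ) := by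
      calc b ≤ (2 : ℝ) ^ (-(1 - ε)) := Real.rpow_le_rpow_of_nonpos two_pos hp2 (by linarith)
        _ ≤ _ := Real.rpow_le_rpow_of_exponent_le one_le_two (by linarith)
    have h2 : (2 : ℝ) ^ (-(1 / 2) : ℝ) ≤ 3 / 4 := by
      have h3 : ((2 : ℝ) ^ (-(1 / 2) : ℝ)) ^ 2 = 1 / 2 := by
        rw [← Real.rpow_natCast, ← Real.rpow_mul (by norm_num)]; norm_num
      have h4 : (0 : ℝ) ≤ (2 : ℝ) ^ (-(1 / 2) : ℝ) := by positivity
      nlinarith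
    linarith
  have hae : a = (p : ℝ)⁻¹ * Real.exp (-x) := by
    rw [ha, Real.rpow_def_of_pos hp0, ← Real.exp_log (inv_pos.2 hp0), Real.log_inv, ← Real.exp_add]
    congr 1; rw [hx]; ring
  have hbe : b = (p : ℝ)⁻¹ * Real.exp x := by
    rw [hb, Real.rpow_def_of_pos hp0, ← Real.exp_log (inv_pos.2 hp0), Real.log_inv, ← Real.exp_add]
    congr 1; rw [hx]; ring
  have hab : b - a ≤ 2 * Real.exp 1 * (ε * (Real.log p / p)) := by
    have h1 : Real.exp (-x) = Real.exp x * Real.exp (-(2 * x)) := by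
      rw [← Real.exp_add]; congr 1; ring
    have h2 : 1 - 2 * x ≤ Real.exp (-(2 * x)) := by linarith [Real.add_one_le_exp (-(2 * x))]
    have h3 : Real.exp x ≤ Real.exp 1 := Real.exp_le_exp.2 hpε
    calc b - a = (p : ℝ)⁻¹ * (Real.exp x * (1 - Real.exp (-(2 * x)))) := by rw [hae, hbe, h1]; ring
      _ ≤ (p : ℝ)⁻¹ * (Real.exp x * (2 * x)) := by gcongr; linarith
      _ ≤ (p : ℝ)⁻¹ * (Real.exp 1 * (2 * x)) := by gcongr
      _ = _ := by rw [hx]; ring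
  have hab0 : a ≤ b := by
    rw [hae, hbe]; gcongr; linarith
  have h1b : 0 < 1 - b := by linarith
  have h1a : 0 < 1 - a := by linarith
  have hkey : (1 - a) ≤ (1 - b) * Real.exp (8 * Real.exp 1 * (ε * (Real.log p / p))) := by
    have h1 : 4 * (b - a) ≤ 8 * Real.exp 1 * (ε * (Real.log p / p)) := by linarith
    have h2 : 1 + 4 * (b - a) ≤ Real.exp (8 * Real.exp 1 * (ε * (Real.log p / p))) := by
      linarith [Real.add_one_le_exp (8 * Real.exp 1 * (ε * (Real.log p / p)))]
    calc (1 - a) ≤ (1 - b) * (1 + 4 * (b - a)) := by nlinarith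
      _ ≤ _ := by gcongr
  rw [inv_eq_one_div, div_le_iff₀ h1b, mul_comm _ (1 - b), mul_left_comm]
  rw [← div_eq_inv_mul, one_le_div h1a]
  exact hkey

theorem card_primeFactors_mul_log_two_le {q : ℕ} (hq : q ≠ 0) :
    (q.primeFactors.card : ℝ) * Real.log 2 ≤ Real.log q := by
  have h1 : 2 ^ q.primeFactors.card ≤ q := by
    calc 2 ^ q.primeFactors.card ≤ ∏ p ∈ q.primeFactors, p :=
          Finset.pow_card_le_prod _ _ _ fun p hp => (Nat.prime_of_mem_primeFactors hp).two_le
      _ ≤ q := Nat.le_of_dvd (Nat.pos_of_ne_zero hq) (Nat.prod_primeFactors_dvd q)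
  rw [← Real.log_pow]
  exact Real.log_le_log (by positivity) (by exact_mod_cast h1)

/-- A form of Grönwall's bound: `∑_{d ∣ q} d ^ (-1 + 1 / log log q) ≪ log log q`. -/
theorem sum_divisors_rpow_le_loglog :
    ∃ C : ℝ, 0 < C ∧ ∀ q : ℕ, 3 ≤ Real.log (Real.log q) →
      ∑ d ∈ q.divisors, (d : ℝ) ^ (-(1 - 1 / Real.log (Real.log q))) ≤
        C * Real.log (Real.log q) := by
  refine ⟨2 * Real.exp (8 * Real.exp 1 * (1 + Real.log 4)) *
    Real.exp (2 * Real.exp 1 / Real.log 2), by positivity, fun q hq => ?_⟩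
  set y := Real.log q with hy
  set L := Real.log y with hL
  set ε := 1 / L with hεdef
  have hLpos : 0 < L := by linarith
  have hε : 0 < ε := by positivity
  have hε' : ε ≤ 1 / 2 := by
    rw [hεdef]; exact one_div_le_one_div_of_le (by norm_num) (by linarith)
  have hεL : ε * L = 1 := by rw [hεdef]; field_simp
  have hy0 : 0 < y := by
    by_contra h
    have h1 : 0 ≤ y := Real.log_natCast_nonneg q
    have h2 : y = 0 := le_antisymm (not_lt.1 h) h1
    rw [hL, h2, Real.log_zero] at hLpos
    exact lt_irrefl _ hLpos
  have hyexp : Real.exp 3 ≤ y := by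
    rw [← Real.exp_log hy0]; exact Real.exp_le_exp.2 hq
  have hy1 : 2 * Real.exp 1 ≤ y := by
    refine le_trans ?_ hyexp
    have h2 : Real.exp 3 = Real.exp 1 * Real.exp 2 := by rw [← Real.exp_add]; norm_num
    rw [h2, mul_comm]
    gcongr
    linarith [Real.add_one_le_exp (2 : ℝ)]
  have hq0 : q ≠ 0 := by
    rintro rfl
    simp [hy] at hy0
  have hy1' : 1 ≤ y := by linarith [Real.add_one_le_exp (1 : ℝ)]
  refine (sum_divisors_rpow_neg_le (by linarith) hq0).trans ?_
  set N := ⌊y⌋₊ with hN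
  have hN1 : 1 ≤ N := Nat.le_floor (by simpa using hy1')
  have hNy : (N : ℝ) ≤ y := Nat.floor_le hy0.le
  -- Primes up to N = ⌊log q⌋ are compared with the Euler product at 1 + ε, which is at most 1 +
  -- 1/ε, at a bounded cost by Mertens since ε log N ≤ 1. There are at most log q / log 2 larger
  -- primes, each with p^(-(1-ε)) ≤ e/log q, so their product is bounded.
  rw [← Finset.prod_filter_mul_prod_filter_not q.primeFactors (· ≤ N)]
  have hpos : ∀ p : ℕ, p.Prime → ∀ s : ℝ, 0 < s → 0 < 1 - (p : ℝ) ^ (-s) := by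
    intro p hp s hs
    have h := natRpowNegHom_norm_lt_one hs hp
    change ‖(p : ℝ) ^ (-s)‖ < 1 at h
    rw [Real.norm_of_nonneg (by positivity)] at h
    linarith
  have hsmall : ∏ p ∈ q.primeFactors.filter (· ≤ N), (1 - (p : ℝ) ^ (-(1 - ε)))⁻¹ ≤
      2 * L * Real.exp (8 * Real.exp 1 * (1 + Real.log 4)) := by
    have hsub : q.primeFactors.filter (· ≤ N) ⊆ Nat.primesLE N := by
      intro p hp
      rw [Finset.mem_filter] at hp
      rw [Nat.mem_primesLE]
      exact ⟨hp.2, Nat.prime_of_mem_primeFactors hp.1⟩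
    have hmem : ∀ p ∈ Nat.primesLE N, p.Prime ∧ p ≤ N := by
      intro p hp; rw [Nat.mem_primesLE] at hp; exact hp.symm
    calc _ ≤ ∏ p ∈ Nat.primesLE N, (1 - (p : ℝ) ^ (-(1 - ε)))⁻¹ := by
          rw [← Finset.prod_sdiff hsub]
          refine le_mul_of_one_le_left ?_ ?_
          · exact Finset.prod_nonneg fun p hp =>
              inv_nonneg.2 (hpos p (hmem p (hsub hp)).1 _ (by linarith)).le
          · refine Finset.one_le_prod fun p hp => ?_
            have h1 := hpos p (hmem p (Finset.sdiff_subset hp)).1 (1 - ε) (by linarith)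
            refine (one_le_inv₀ h1).2 ?_
            have : (0 : ℝ) ≤ (p : ℝ) ^ (-(1 - ε)) := by positivity
            linarith
      _ ≤ ∏ p ∈ Nat.primesLE N, ((1 - (p : ℝ) ^ (-(1 + ε)))⁻¹ *
            Real.exp (8 * Real.exp 1 * (ε * (Real.log p / p)))) := by
          refine Finset.prod_le_prod ?_ ?_
          · intro p hp
            exact inv_nonneg.2 (hpos p (hmem p hp).1 _ (by linarith)).le
          · intro p hp
            obtain ⟨h1, h2⟩ := hmem p hp
            refine inv_one_sub_rpow_le hε hε' h1.two_le ?_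
            have h3 : Real.log p ≤ L :=
              Real.log_le_log (by exact_mod_cast h1.pos) (le_trans (by exact_mod_cast h2) hNy)
            calc ε * Real.log p ≤ ε * L := by gcongr
              _ = 1 := hεL
      _ = (∏ p ∈ Nat.primesLE N, (1 - (p : ℝ) ^ (-(1 + ε)))⁻¹) *
            Real.exp (8 * Real.exp 1 * (ε * ∑ p ∈ Nat.primesLE N, Real.log p / p)) := by
          rw [Finset.prod_mul_distrib, ← Real.exp_sum, Finset.mul_sum, Finset.mul_sum]
      _ ≤ (1 + 1 / ε) * Real.exp (8 * Real.exp 1 * (1 + Real.log 4)) := by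
          have h1 := prod_primesBelow_rpow_le hε (N + 1)
          have h2 : ε * ∑ p ∈ Nat.primesLE N, Real.log p / p ≤ 1 + Real.log 4 := by
            have h3 := sum_primesLE_log_div_le hN1
            have h4 : Real.log N ≤ L := Real.log_le_log (by exact_mod_cast hN1) hNy
            have h5 : 0 ≤ Real.log 4 := Real.log_nonneg (by norm_num)
            calc _ ≤ ε * (L + Real.log 4) := by gcongr; linarith
              _ = 1 + ε * Real.log 4 := by rw [mul_add, hεL]
              _ ≤ 1 + 1 * Real.log 4 := by gcongr; linarith
              _ = _ := by ring
          have h6 : Nat.primesLE N = (N + 1).primesBelow := rfl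
          rw [← h6] at h1
          gcongr
      _ ≤ _ := by
          gcongr
          rw [hεdef, one_div_one_div]; linarith
  have hbig : ∏ p ∈ q.primeFactors.filter (fun p => ¬ p ≤ N), (1 - (p : ℝ) ^ (-(1 - ε)))⁻¹ ≤
      Real.exp (2 * Real.exp 1 / Real.log 2) := by
    have hl2 : 0 < Real.log 2 := Real.log_pos one_lt_two
    calc _ ≤ ∏ p ∈ q.primeFactors.filter (fun p => ¬ p ≤ N), Real.exp (2 * Real.exp 1 / y) := by
          refine Finset.prod_le_prod ?_ ?_
          · intro p hp
            rw [Finset.mem_filter] at hp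
            exact inv_nonneg.2 (hpos p (Nat.prime_of_mem_primeFactors hp.1) _ (by linarith)).le
          · intro p hp
            rw [Finset.mem_filter] at hp
            have h1 : y ≤ p := (Nat.lt_of_floor_lt (not_le.1 hp.2)).le
            have h2 : (p : ℝ) ^ (-(1 - ε)) ≤ Real.exp 1 / y := by
              calc (p : ℝ) ^ (-(1 - ε)) ≤ y ^ (-(1 - ε)) :=
                    Real.rpow_le_rpow_of_nonpos hy0 h1 (by linarith)
                _ = Real.exp 1 / y := by
                    rw [Real.rpow_def_of_pos hy0, show Real.log y * -(1 - ε) = ε * L - L by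
                      rw [hL]; ring, hεL, Real.exp_sub, hL, Real.exp_log hy0]
            have h3 : Real.exp 1 / y ≤ 1 / 2 := by rw [div_le_iff₀ hy0]; linarith
            set z := Real.exp 1 / y with hz
            have hz0 : 0 ≤ z := by positivity
            calc (1 - (p : ℝ) ^ (-(1 - ε)))⁻¹ ≤ (1 - z)⁻¹ := by gcongr; linarith
              _ ≤ 1 + 2 * z := by
                rw [inv_le_iff_one_le_mul₀ (by linarith)]; nlinarith
              _ ≤ Real.exp (2 * z) := by linarith [Real.add_one_le_exp (2 * z)]
              _ = _ := by rw [hz]; ring_nf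
      _ = Real.exp ((q.primeFactors.filter (fun p => ¬ p ≤ N)).card * (2 * Real.exp 1 / y)) := by
          rw [Finset.prod_const, ← Real.exp_nat_mul]
      _ ≤ _ := by
          rw [Real.exp_le_exp]
          have h1 := card_primeFactors_mul_log_two_le hq0
          have h2 : ((q.primeFactors.filter (fun p => ¬ p ≤ N)).card : ℝ) ≤ q.primeFactors.card := by
            exact_mod_cast Finset.card_filter_le _ _
          have h3 : ((q.primeFactors.filter (fun p => ¬ p ≤ N)).card : ℝ) ≤ y / Real.log 2 := by
            rw [le_div_iff₀ hl2]; exact le_trans (by gcongr) h1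
          calc _ ≤ y / Real.log 2 * (2 * Real.exp 1 / y) := by gcongr
            _ = _ := by field_simp
  calc _ ≤ (2 * L * Real.exp (8 * Real.exp 1 * (1 + Real.log 4))) *
        Real.exp (2 * Real.exp 1 / Real.log 2) := by
        refine mul_le_mul hsmall hbig ?_ (by positivity)
        refine Finset.prod_nonneg fun p hp => ?_
        rw [Finset.mem_filter] at hp
        exact inv_nonneg.2 (hpos p (Nat.prime_of_mem_primeFactors hp.1) _ (by linarith)).le
    _ = _ := by ring

end Gronwall

/-! ### Exponential sums. -/

section ExponentialSums

/-- The additive character `x ↦ exp (2 π i x)`. -/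
noncomputable def addChar (x : ℝ) : ℂ := Complex.exp (2 * Real.pi * x * Complex.I)

theorem addChar_add (x y : ℝ) : addChar (x + y) = addChar x * addChar y := by
  rw [addChar, addChar, addChar, ← Complex.exp_add]; congr 1; push_cast; ring

theorem norm_addChar (x : ℝ) : ‖addChar x‖ = 1 := by
  rw [addChar, show (2 * Real.pi * x * Complex.I : ℂ) = ((2 * Real.pi * x : ℝ) : ℂ) * Complex.I by
    push_cast; ring, Complex.norm_exp_ofReal_mul_I]

theorem addChar_nat_mul (n : ℕ) (x : ℝ) : addChar (n * x) = addChar x ^ n := by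
  rw [addChar, addChar, ← Complex.exp_nat_mul]; congr 1; push_cast; ring

theorem conj_addChar (x : ℝ) : (starRingEnd ℂ) (addChar x) = addChar (-x) := by
  rw [addChar, addChar, ← Complex.exp_conj]; congr 1
  simp [map_ofNat]

theorem addChar_sub_int (x : ℝ) (m : ℤ) : addChar (x - m) = addChar x := by
  rw [addChar, addChar, Complex.exp_eq_exp_iff_exists_int]
  exact ⟨-m, by push_cast; ring⟩

/-- For y the signed distance to the nearest integer, the norm is 2|sin πy|, and Jordan's inequality
applies. -/
theorem four_mul_distInt_le_norm (x : ℝ) : 4 * distInt x ≤ ‖addChar x - 1‖ := by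
  rw [← addChar_sub_int x (round x), distInt]
  set y := x - round x with hy
  have hy2 : |y| ≤ 1 / 2 := abs_sub_round x
  have h1 : ‖addChar y - 1‖ = ‖2 * Real.sin (2 * Real.pi * y / 2)‖ := by
    rw [addChar, ← Complex.norm_exp_I_mul_ofReal_sub_one]
    congr 3; push_cast; ring
  rw [h1, norm_mul, Real.norm_eq_abs, Real.norm_eq_abs, abs_two,
    show 2 * Real.pi * y / 2 = Real.pi * y by ring]
  have h2 := Real.mul_abs_le_abs_sin (x := Real.pi * y) (by
    rw [abs_mul, abs_of_pos Real.pi_pos]; nlinarith [Real.pi_pos])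
  rw [abs_mul, abs_of_pos Real.pi_pos] at h2
  have h3 : 2 / Real.pi * (Real.pi * |y|) = 2 * |y| := by field_simp
  linarith

theorem norm_sum_addChar_le (N : ℕ) {a δ : ℝ} (hδ : 0 < δ) (h : δ ≤ distInt a) (b : ℝ) :
    ‖∑ n ∈ Finset.range N, addChar (n * a + b)‖ ≤ 1 / (2 * δ) := by
  have h1 := four_mul_distInt_le_norm a
  have hne : addChar a ≠ 1 := by
    intro h2; rw [h2, sub_self, norm_zero] at h1; linarith
  have hpos : 0 < ‖addChar a - 1‖ := by linarith
  simp_rw [addChar_add, addChar_nat_mul]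
  rw [← Finset.sum_mul, geom_sum_eq hne, norm_mul, norm_addChar, mul_one, norm_div,
    div_le_div_iff₀ hpos (by positivity)]
  have h2 : ‖addChar a ^ N - 1‖ ≤ 2 := by
    refine (norm_sub_le _ _).trans ?_
    rw [norm_pow, norm_addChar]; norm_num
  nlinarith

/-- Expanding the square, each diagonal pair gives N, and each off-diagonal pair gives a geometric
sum whose ratio is δ-far from 1. -/
theorem sum_norm_sq_sum_addChar_le {ι : Type*} (I : Finset ι) (a b : ι → ℝ) (N : ℕ) {δ : ℝ}
    (hδ : 0 < δ) (h : ∀ i ∈ I, ∀ j ∈ I, i ≠ j → δ ≤ distInt (a i - a j)) :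
    ∑ n ∈ Finset.range N, ‖∑ i ∈ I, addChar (n * a i + b i)‖ ^ 2 ≤
      I.card * N + (I.card : ℝ) ^ 2 * (1 / (2 * δ)) := by
  classical
  have h1 : ((∑ n ∈ Finset.range N, ‖∑ i ∈ I, addChar (n * a i + b i)‖ ^ 2 : ℝ) : ℂ) =
      ∑ i ∈ I, ∑ j ∈ I, ∑ n ∈ Finset.range N, addChar (n * (a i - a j) + (b i - b j)) := by
    push_cast
    have h2 : ∀ n : ℕ, ((‖∑ i ∈ I, addChar (n * a i + b i)‖ : ℂ)) ^ 2 =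
        ∑ i ∈ I, ∑ j ∈ I, addChar (n * (a i - a j) + (b i - b j)) := by
      intro n
      rw [← Complex.mul_conj', map_sum, Finset.sum_mul_sum]
      refine Finset.sum_congr rfl fun i _ => Finset.sum_congr rfl fun j _ => ?_
      rw [conj_addChar, ← addChar_add]; congr 1; ring
    simp_rw [h2]
    rw [Finset.sum_comm]
    exact Finset.sum_congr rfl fun i _ => Finset.sum_comm
  have h3 : ∑ n ∈ Finset.range N, ‖∑ i ∈ I, addChar (n * a i + b i)‖ ^ 2 =
      ‖∑ i ∈ I, ∑ j ∈ I, ∑ n ∈ Finset.range N, addChar (n * (a i - a j) + (b i - b j))‖ := by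
    rw [← h1, Complex.norm_real, Real.norm_of_nonneg (Finset.sum_nonneg fun _ _ => by positivity)]
  rw [h3]
  calc _ ≤ ∑ i ∈ I, ∑ j ∈ I, ((if i = j then (N : ℝ) else 0) + 1 / (2 * δ)) := by
        refine norm_sum_le_of_le _ fun i hi => norm_sum_le_of_le _ fun j hj => ?_
        have hd : 0 ≤ 1 / (2 * δ) := by positivity
        by_cases hij : i = j
        · rw [if_pos hij]
          have h4 : ‖∑ n ∈ Finset.range N, addChar (n * (a i - a j) + (b i - b j))‖ ≤ N := by
            refine (norm_sum_le _ _).trans ?_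
            simp [norm_addChar]
          linarith
        · rw [if_neg hij, zero_add]
          exact norm_sum_addChar_le N hδ (h i hi j hj hij) _
    _ = _ := by
        simp only [Finset.sum_add_distrib, Finset.sum_ite_eq, Finset.sum_const, nsmul_eq_mul]
        rw [Finset.sum_ite_mem, Finset.inter_self, Finset.sum_const, nsmul_eq_mul]
        ring

theorem half_le_norm_sum_addChar {H : ℕ} {x : ℝ} (h : H * distInt x ≤ 1 / 6) :
    (H : ℝ) / 2 ≤ ‖∑ k ∈ Finset.range H, addChar (k * x)‖ := by
  refine le_trans ?_ (Complex.re_le_norm _)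
  rw [Complex.re_sum]
  have h1 : ∀ k ∈ Finset.range H, (1 : ℝ) / 2 ≤ (addChar (k * x)).re := by
    intro k hk
    have hk' : (k : ℝ) ≤ H := by exact_mod_cast (Finset.mem_range.1 hk).le
    have h2 : addChar (k * x) = addChar (k * (x - round x)) := by
      rw [← addChar_sub_int (k * x) (k * round x)]; congr 1; push_cast; ring
    rw [h2, addChar, show (2 * Real.pi * (k * (x - round x) : ℝ) * Complex.I : ℂ) =
      ((2 * Real.pi * (k * (x - round x)) : ℝ) : ℂ) * Complex.I by push_cast; ring,
      Complex.exp_ofReal_mul_I_re, ← Real.cos_abs, ← Real.cos_pi_div_three]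
    have h3 : |2 * Real.pi * (k * (x - round x))| ≤ Real.pi / 3 := by
      rw [abs_mul, abs_mul, abs_mul, abs_two, abs_of_pos Real.pi_pos, Nat.abs_cast]
      have h4 : (k : ℝ) * |x - round x| ≤ 1 / 6 := le_trans (by gcongr; exact le_rfl) h
      nlinarith [Real.pi_pos]
    refine Real.cos_le_cos_of_nonneg_of_le_pi (abs_nonneg _) ?_ h3
    linarith [Real.pi_pos]
  calc (H : ℝ) / 2 = ∑ k ∈ Finset.range H, (1 : ℝ) / 2 := by simp; ring
    _ ≤ _ := Finset.sum_le_sum h1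

/-- A detector for closeness to an integer: a sum of length H ≍ 1/η shows no cancellation when x is
within η of an integer. H is ⌊1/(6η)⌋, or 1 when that vanishes. -/
theorem exists_length_addChar {η : ℝ} (hη : 0 < η) (hη1 : η ≤ 1) :
    ∃ H : ℕ, 1 ≤ H ∧ (H : ℝ) ≤ 1 / η ∧ 1 ≤ 12 * η * H ∧
      ∀ x, distInt x ≤ η → (H : ℝ) / 2 ≤ ‖∑ k ∈ Finset.range H, addChar (k * x)‖ := by
  by_cases h6 : 1 ≤ 1 / (6 * η)
  · refine ⟨⌊1 / (6 * η)⌋₊, Nat.le_floor (by simpa using h6), ?_, ?_, fun x hx => ?_⟩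
    · refine (Nat.floor_le (by positivity)).trans ?_
      exact one_div_le_one_div_of_le hη (by linarith)
    · have h1 := Nat.lt_floor_add_one (1 / (6 * η))
      have h2 : (1 : ℝ) ≤ ⌊1 / (6 * η)⌋₊ := by exact_mod_cast Nat.le_floor (by simpa using h6)
      have h3 : 1 / (6 * η) ≤ 2 * ⌊1 / (6 * η)⌋₊ := by linarith
      rw [div_le_iff₀ (by positivity)] at h3
      linarith
    · refine half_le_norm_sum_addChar ?_
      calc _ ≤ 1 / (6 * η) * η := by
            gcongr
            exacts [distInt_nonneg x, Nat.floor_le (by positivity)]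
        _ = 1 / 6 := by field_simp
  · refine ⟨1, le_rfl, ?_, ?_, fun x _ => ?_⟩
    · rw [Nat.cast_one, le_div_iff₀ hη]; linarith
    · rw [not_le, div_lt_one (by positivity)] at h6
      push_cast; linarith
    · rw [Finset.sum_range_one, norm_addChar]; norm_num

end ExponentialSums

/-! ### Counting visits of a Diophantine rotation. -/

section Counting

variable {γ β ρ c : ℝ}

/-- Upper bound for the number of visits to a box of the orbit of a rotation by a Diophantine
pair. -/
theorem card_box_le (hρ : 0 < ρ) (hc : 0 < c)
    (hdio : ∀ n m : ℤ, (n ≠ 0 ∨ m ≠ 0) →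
      c * (max |(n : ℝ)| |(m : ℝ)|) ^ (-ρ) ≤ distInt (n * γ + m * β))
    {d N : ℕ} (hd : 1 ≤ d) {η₀ η₁ η₂ : ℝ} (h0 : 0 < η₀) (h1 : η₀ ≤ η₁) (h2 : η₀ ≤ η₂)
    (h1' : η₁ ≤ 1) (h2' : η₂ ≤ 1) (α : ℝ) :
    (((Finset.range N).filter fun n : ℕ =>
        distInt (n * γ) ≤ η₁ ∧ distInt (n * (d * β) + α) ≤ η₂).card : ℝ) ≤
      2304 * N * η₁ * η₂ + 8 / c * (d / η₀) ^ ρ := by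
  obtain ⟨H₁, hH1, hH1', hH1'', hS1⟩ := exists_length_addChar (h0.trans_le h1) h1'
  obtain ⟨H₂, hH2, hH2', hH2'', hS2⟩ := exists_length_addChar (h0.trans_le h2) h2'
  have hdR : (1 : ℝ) ≤ d := by exact_mod_cast hd
  -- The frequencies are iγ + k(dβ) with i < H₁, k < H₂. Their differences have integer coefficients
  -- of size at most d/η₀ in γ and β, so the Diophantine condition separates them by δ.
  set δ := c * (d / η₀) ^ (-ρ) with hδ
  have hδ0 : 0 < δ := by positivity
  have hsep : ∀ i ∈ Finset.range H₁ ×ˢ Finset.range H₂, ∀ j ∈ Finset.range H₁ ×ˢ Finset.range H₂,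
      i ≠ j → δ ≤ distInt ((i.1 * γ + i.2 * (d * β)) - (j.1 * γ + j.2 * (d * β))) := by
    rintro ⟨i, k⟩ hi ⟨j, l⟩ hj hij
    simp only [Finset.mem_product, Finset.mem_range] at hi hj
    have hne : ((i : ℤ) - j ≠ 0 ∨ ((k : ℤ) - l) * d ≠ 0) := by
      by_contra hcon
      push Not at hcon
      have hd0 : (d : ℤ) ≠ 0 := by exact_mod_cast (by omega : d ≠ 0)
      rcases mul_eq_zero.1 hcon.2 with h | h
      · exact hij (by rw [Prod.mk.injEq]; omega)
      · exact hd0 h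
    have h3 := hdio _ _ hne
    have h4 : (((i : ℤ) - j : ℤ) : ℝ) * γ + (((k : ℤ) - l) * d : ℤ) * β =
        (i * γ + k * (d * β)) - (j * γ + l * (d * β)) := by push_cast; ring
    rw [h4] at h3
    refine le_trans ?_ h3
    rw [hδ]
    have hinv1 : (1 : ℝ) / η₁ ≤ 1 / η₀ := one_div_le_one_div_of_le h0 h1
    have hinv2 : (1 : ℝ) / η₂ ≤ 1 / η₀ := one_div_le_one_div_of_le h0 h2
    have hinv0 : 0 < 1 / η₀ := by positivity
    have h5 : max |(((i : ℤ) - j : ℤ) : ℝ)| |((((k : ℤ) - l) * d : ℤ) : ℝ)| ≤ d / η₀ := by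
      have e1 : |(((i : ℤ) - j : ℤ) : ℝ)| ≤ 1 / η₀ := by
        have : |(i : ℤ) - j| ≤ H₁ := by rw [abs_le]; omega
        have : |(((i : ℤ) - j : ℤ) : ℝ)| ≤ H₁ := by rw [← Int.cast_abs]; exact_mod_cast this
        linarith
      have e2 : |(((k : ℤ) - l : ℤ) : ℝ)| ≤ 1 / η₀ := by
        have : |(k : ℤ) - l| ≤ H₂ := by rw [abs_le]; omega
        have : |(((k : ℤ) - l : ℤ) : ℝ)| ≤ H₂ := by rw [← Int.cast_abs]; exact_mod_cast this
        linarith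
      refine max_le ?_ ?_
      · refine e1.trans ?_
        gcongr
      · rw [Int.cast_mul, abs_mul, Int.cast_natCast, Nat.abs_cast]
        calc _ ≤ 1 / η₀ * d := by gcongr
          _ = _ := by ring
    have h6 : 0 < max |(((i : ℤ) - j : ℤ) : ℝ)| |((((k : ℤ) - l) * d : ℤ) : ℝ)| := by
      rcases hne with h | h
      · exact lt_max_of_lt_left (abs_pos.2 (by exact_mod_cast h))
      · exact lt_max_of_lt_right (abs_pos.2 (by exact_mod_cast h))
    gcongr ?_ * ?_
    exact Real.rpow_le_rpow_of_nonpos h6 h5 (by linarith)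
  have hmain := sum_norm_sq_sum_addChar_le (Finset.range H₁ ×ˢ Finset.range H₂)
    (fun i => i.1 * γ + i.2 * (d * β)) (fun i => i.2 * α) N hδ0 hsep
  rw [Finset.card_product, Finset.card_range, Finset.card_range] at hmain
  push_cast at hmain
  set A := (Finset.range N).filter fun n : ℕ =>
        distInt (n * γ) ≤ η₁ ∧ distInt (n * (d * β) + α) ≤ η₂
  -- At a visit the double sum factors into two detectors and has norm at least H₁H₂/4. Comparing
  -- with the mean square counts the visits; 2304 is 16 · 144, with 144 from 1 ≤ 12η₁H₁ · 12η₂H₂.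
  have hlow : (A.card : ℝ) * ((H₁ : ℝ) / 2 * (H₂ / 2)) ^ 2 ≤
      ∑ n ∈ Finset.range N, ‖∑ i ∈ Finset.range H₁ ×ˢ Finset.range H₂,
        addChar (n * (i.1 * γ + i.2 * (d * β)) + i.2 * α)‖ ^ 2 := by
    rw [← nsmul_eq_mul, ← Finset.sum_const]
    refine (Finset.sum_le_sum (s := A) fun n hn => ?_).trans
      (Finset.sum_le_sum_of_subset_of_nonneg (Finset.filter_subset _ _) fun _ _ _ => by positivity)
    have hn' := (Finset.mem_filter.1 hn).2
    have e1 : ∑ i ∈ Finset.range H₁ ×ˢ Finset.range H₂,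
        addChar (n * (i.1 * γ + i.2 * (d * β)) + i.2 * α) =
        (∑ k ∈ Finset.range H₁, addChar (k * (n * γ))) *
          ∑ k ∈ Finset.range H₂, addChar (k * (n * (d * β) + α)) := by
      rw [Finset.sum_mul_sum, ← Finset.sum_product']
      refine Finset.sum_congr rfl fun i _ => ?_
      rw [← addChar_add]; congr 1; ring
    rw [e1, norm_mul]
    gcongr
    · exact hS1 _ hn'.1
    · exact hS2 _ hn'.2
  have h3 := hlow.trans hmain
  have hP1 : (0 : ℝ) < H₁ := by exact_mod_cast hH1
  have hP2 : (0 : ℝ) < H₂ := by exact_mod_cast hH2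
  set P : ℝ := H₁ * H₂ with hP
  have hPpos : 0 < P := by positivity
  have h4 : (A.card : ℝ) * P ^ 2 ≤ 16 * (P * N + P ^ 2 * (1 / (2 * δ))) := by
    have : (A.card : ℝ) * ((H₁ : ℝ) / 2 * (H₂ / 2)) ^ 2 = A.card * P ^ 2 / 16 := by rw [hP]; ring
    rw [this] at h3
    linarith
  have h5 : 1 ≤ 144 * (η₁ * η₂) * P := by
    calc (1 : ℝ) ≤ (12 * η₁ * H₁) * (12 * η₂ * H₂) := one_le_mul_of_one_le_of_one_le hH1'' hH2''
      _ = _ := by rw [hP]; ring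
  have h6 : P * N ≤ P ^ 2 * (144 * N * (η₁ * η₂)) := by
    have hPN : 0 ≤ P * N := by positivity
    calc P * N = P * N * 1 := by ring
      _ ≤ P * N * (144 * (η₁ * η₂) * P) := by gcongr
      _ = _ := by ring
  have h7 : (A.card : ℝ) * P ^ 2 ≤ (2304 * N * η₁ * η₂ + 8 * (1 / δ)) * P ^ 2 := by
    have : 16 * (P ^ 2 * (1 / (2 * δ))) = 8 * (1 / δ) * P ^ 2 := by field_simp; norm_num
    nlinarith
  have h8 := le_of_mul_le_mul_right h7 (by positivity)
  refine h8.trans (le_of_eq ?_)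
  rw [hδ, Real.rpow_neg (by positivity)]
  field_simp

/-- Two such n differ by some k with ‖kγ‖ ≤ 2η, hence by at least G. Each n ≥ 1 is itself at least
G, which is why the bound has no additive 1. -/
theorem card_near_le (hρ : 0 < ρ) (hc : 0 < c)
    (hdio : ∀ n m : ℤ, (n ≠ 0 ∨ m ≠ 0) →
      c * (max |(n : ℝ)| |(m : ℝ)|) ^ (-ρ) ≤ distInt (n * γ + m * β))
    {η N : ℝ} (hη : 0 < η) (hN : 0 ≤ N) (s : Finset ℕ)
    (hs : ∀ n ∈ s, 1 ≤ n ∧ (n : ℝ) ≤ N ∧ distInt (n * γ) ≤ η) :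
    (s.card : ℝ) ≤ N * (2 * η / c) ^ (1 / ρ) := by
  set G := (c / (2 * η)) ^ (1 / ρ) with hG
  have hG0 : 0 < G := by positivity
  have hgap : ∀ k : ℤ, k ≠ 0 → distInt (k * γ) ≤ 2 * η → G ≤ |(k : ℝ)| := by
    intro k hk h
    have h1 := hdio k 0 (Or.inl hk)
    have hk' : 0 < |(k : ℝ)| := abs_pos.2 (by exact_mod_cast hk)
    simp only [Int.cast_zero, abs_zero, zero_mul, add_zero, max_eq_left hk'.le] at h1
    have h2 : c / (2 * η) ≤ |(k : ℝ)| ^ ρ := by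
      rw [Real.rpow_neg hk'.le, ← div_eq_mul_inv, div_le_iff₀ (by positivity)] at h1
      rw [div_le_iff₀ (by positivity)]
      have h3 : distInt (k * γ) * |(k : ℝ)| ^ ρ ≤ 2 * η * |(k : ℝ)| ^ ρ := by gcongr
      linarith
    calc G ≤ (|(k : ℝ)| ^ ρ) ^ (1 / ρ) := by rw [hG]; gcongr
      _ = _ := by rw [← Real.rpow_mul hk'.le, mul_one_div_cancel hρ.ne', Real.rpow_one]
  have hinj : Set.InjOn (fun n : ℕ => ⌊(n : ℝ) / G⌋₊) s := by
    intro m hm n hn hmn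
    by_contra hne
    have h1 : distInt (((m : ℤ) - n : ℤ) * γ) ≤ 2 * η := by
      have e : (((m : ℤ) - n : ℤ) : ℝ) * γ = m * γ - n * γ := by push_cast; ring
      have hm' := (hs m hm).2.2
      have hn' := (hs n hn).2.2
      rw [distInt_eq_norm] at hm' hn' ⊢
      rw [e, AddCircle.coe_sub]
      exact (norm_sub_le _ _).trans (by linarith)
    have h2 := hgap _ (by omega) h1
    simp only at hmn
    have a1 := Nat.floor_le (a := (m : ℝ) / G) (by positivity)
    have a2 := Nat.lt_floor_add_one ((m : ℝ) / G)
    have b1 := Nat.floor_le (a := (n : ℝ) / G) (by positivity)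
    have b2 := Nat.lt_floor_add_one ((n : ℝ) / G)
    rw [hmn] at a1 a2
    have h3 : |(m : ℝ) / G - n / G| < 1 := by rw [abs_lt]; constructor <;> linarith
    rw [← sub_div, abs_div, abs_of_pos hG0, div_lt_one hG0] at h3
    push_cast at h2
    linarith
  have hmaps : Set.MapsTo (fun n : ℕ => ⌊(n : ℝ) / G⌋₊) s (Finset.Icc 1 ⌊N / G⌋₊) := by
    intro n hn
    obtain ⟨h1, h2, h3⟩ := hs n hn
    have h4 := hgap n (by omega) (by push_cast; linarith)
    simp only [Finset.coe_Icc, Set.mem_Icc]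
    constructor
    · apply Nat.le_floor
      rw [Nat.cast_one, one_le_div hG0]
      simpa using h4
    · exact Nat.floor_le_floor (by gcongr)
  have h1 := Finset.card_le_card_of_injOn _ hmaps hinj
  rw [Nat.card_Icc, Nat.add_sub_cancel] at h1
  calc (s.card : ℝ) ≤ ⌊N / G⌋₊ := by exact_mod_cast h1
    _ ≤ N / G := Nat.floor_le (by positivity)
    _ = _ := by
      rw [hG, div_eq_mul_inv, ← Real.inv_rpow (by positivity), inv_div]

end Counting

/-! ### Truncated functions, excess functions and size conditions. -/

/-- The truncated approximation function: on its support, `Ψ(r) ‖r β - γ'‖` is comparable with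
`1 / (r log r (log log r) ^ 2)` up to logarithmic factors, and `‖r β - γ'‖` is not too small. -/
structure IsTruncated (β γ' ω B : ℝ) (Ψ : ℕ → ℝ) : Prop where
  nonneg : ∀ r, 0 ≤ Ψ r
  rpow_le : ∀ r, Ψ r ≠ 0 → (r : ℝ) ^ (-ω) ≤ distInt (r * β - γ')
  mul_le : ∀ r, Ψ r ≠ 0 → Ψ r * distInt (r * β - γ') *
    (r * (Real.log r * Real.log (Real.log r) ^ 2)) ≤ B
  one_le : ∀ r, Ψ r ≠ 0 → 1 ≤ Ψ r * (r * Real.log r ^ 3)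

/-- Bounds for a function `e q r` measuring how far two approximation sets are from being
quasi-independent. -/
structure IsExcess (γ : ℝ) (Ψ : ℕ → ℝ) (e : ℕ → ℕ → ℝ) : Prop where
  le_left : ∀ q r, 0 < q → 0 < r → e q r ≤ 2 * q.gcd r * Ψ q / q
  le_right : ∀ q r, 0 < q → 0 < r → e q r ≤ 2 * q.gcd r * Ψ r / r
  near : ∀ q r, 0 < q → q < r → 0 < e q r →
    distInt (((r - q) / q.gcd r : ℕ) * γ) < r / q.gcd r * Ψ q + q / q.gcd r * Ψ r

/-- `q` is large in terms of the parameters. -/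
structure IsLarge (c B κ κ' : ℝ) (q : ℕ) : Prop where
  loglog : 3 ≤ Real.log (Real.log q)
  log_pow : Real.log q ^ 3 ≤ (q : ℝ) ^ (κ / 8)
  const_le : 8 / c ≤ (q : ℝ) ^ κ'
  le_log : B ≤ Real.log q

namespace IsLarge

variable {c B κ κ' : ℝ} {q : ℕ}

theorem log_pos (h : IsLarge c B κ κ' q) : 0 < Real.log q := by
  by_contra hn
  have h2 : Real.log q = 0 := le_antisymm (not_lt.1 hn) (Real.log_natCast_nonneg q)
  have := h.loglog
  rw [h2, Real.log_zero] at this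
  linarith

theorem one_lt (h : IsLarge c B κ κ' q) : (1 : ℝ) < q := by
  by_contra hn
  have := Real.log_nonpos (Nat.cast_nonneg q) (not_lt.1 hn)
  linarith [h.log_pos]

theorem pos (h : IsLarge c B κ κ' q) : 0 < q := by
  have := h.one_lt
  exact_mod_cast (zero_lt_one.trans this)

theorem four_le_log (h : IsLarge c B κ κ' q) : 4 ≤ Real.log q := by
  have h1 := Real.add_one_le_exp (Real.log (Real.log q))
  rw [Real.exp_log h.log_pos] at h1
  linarith [h.loglog]

theorem loglog_le (h : IsLarge c B κ κ' q) : Real.log (Real.log q) ≤ Real.log q := by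
  have := Real.log_le_sub_one_of_pos h.log_pos
  linarith

theorem weight_le (h : IsLarge c B κ κ' q) :
    Real.log q * Real.log (Real.log q) ^ 2 ≤ (q : ℝ) ^ (κ / 8) := by
  refine le_trans ?_ h.log_pow
  have h1 := h.loglog_le
  have h2 := h.loglog
  have h3 := h.log_pos
  calc _ ≤ Real.log q * Real.log q ^ 2 := by gcongr
    _ = _ := by ring

theorem weight_mono (h : IsLarge c B κ κ' q) {r : ℕ} (hr : q ≤ r) :
    Real.log q * Real.log (Real.log q) ^ 2 ≤ Real.log r * Real.log (Real.log r) ^ 2 := by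
  have hq : (0 : ℝ) < q := by exact_mod_cast h.pos
  have h0 := h.log_pos
  have h1 : Real.log q ≤ Real.log r := Real.log_le_log hq (by exact_mod_cast hr)
  have h2 : Real.log (Real.log q) ≤ Real.log (Real.log r) := Real.log_le_log h0 h1
  have h3 := h.loglog
  gcongr

theorem weight_pos (h : IsLarge c B κ κ' q) :
    0 < Real.log q * Real.log (Real.log q) ^ 2 := by
  have h3 := h.loglog
  have := h.log_pos
  positivity

end IsLarge

/-! ### Excess from distant r and from large gcd. -/

section Bounds

variable {γ β γ' ρ c B ω κ κ' : ℝ} {Ψ : ℕ → ℝ} {e : ℕ → ℕ → ℝ}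

/-- A pointwise upper bound. -/
theorem IsTruncated.le_rpow (hΨ : IsTruncated β γ' ω B Ψ) {q r : ℕ} (hq : IsLarge c B κ κ' q)
    (hqr : q ≤ r) : Ψ r ≤ (r : ℝ) ^ (-1 + ω) := by
  by_cases h0 : Ψ r = 0
  · rw [h0]; positivity
  have hr0 : (0 : ℝ) < r := by exact_mod_cast hq.pos.trans_le hqr
  have h1 := hΨ.mul_le r h0
  have h2 := hΨ.rpow_le r h0
  have h3 : B ≤ Real.log r * Real.log (Real.log r) ^ 2 := by
    refine le_trans ?_ (hq.weight_mono hqr)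
    have h4 := hq.loglog
    exact hq.le_log.trans (le_mul_of_one_le_right hq.log_pos.le (one_le_pow₀ (by linarith)))
  have hW : 0 < Real.log r * Real.log (Real.log r) ^ 2 := hq.weight_pos.trans_le (hq.weight_mono hqr)
  set W := Real.log r * Real.log (Real.log r) ^ 2
  have hp := hΨ.nonneg r
  have h4 : Ψ r * (r : ℝ) ^ (-ω) * (r * W) ≤ 1 * W := by
    calc _ ≤ Ψ r * distInt (r * β - γ') * (r * W) := by gcongr
      _ ≤ B := h1
      _ ≤ _ := by linarith
  have h5 : Ψ r * (r : ℝ) ^ (-ω) * r ≤ 1 := by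
    refine le_of_mul_le_mul_right ?_ hW
    linarith
  have h6 : (r : ℝ) ^ (-ω) * r = ((r : ℝ) ^ (-1 + ω))⁻¹ := by
    rw [← Real.rpow_add_one hr0.ne', ← Real.rpow_neg hr0.le]; congr 1; ring
  rw [mul_assoc, h6, ← div_eq_mul_inv, div_le_one (by positivity)] at h5
  exact h5

/-- Group by d = gcd(q, r) and write r = dm: the term becomes d^(-ω) m^(-(1+ω)), so every divisor of
q contributes at most 1 + 1/ω. -/
theorem sum_gcd_mul_rpow_le {q : ℕ} (hq : q ≠ 0) (hω : 0 < ω) (T : Finset ℕ)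
    (hT : ∀ r ∈ T, 0 < r) :
    ∑ r ∈ T, (q.gcd r : ℝ) * (r : ℝ) ^ (-(1 + ω)) ≤ q.divisors.card * (1 + 1 / ω) := by
  rw [← Finset.sum_fiberwise_of_maps_to (s := T) (t := q.divisors) (g := fun r => q.gcd r)
    (fun r _ => Nat.mem_divisors.2 ⟨Nat.gcd_dvd_left q r, hq⟩), ← nsmul_eq_mul, ← Finset.sum_const]
  refine Finset.sum_le_sum fun d hd => ?_
  have hd0 : 0 < d := Nat.pos_of_mem_divisors hd
  have hdR : (1 : ℝ) ≤ d := by exact_mod_cast hd0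
  set S := T.filter fun r => q.gcd r = d
  have hS : ∀ r ∈ S, r = d * (r / d - 1 + 1) := by
    intro r hr
    rw [Finset.mem_filter] at hr
    have hdvd : d ∣ r := hr.2 ▸ Nat.gcd_dvd_right q r
    have hpos : 0 < r / d := Nat.div_pos (Nat.le_of_dvd (hT r hr.1) hdvd) hd0
    rw [Nat.sub_add_cancel hpos, Nat.mul_div_cancel' hdvd]
  have hinj : Set.InjOn (fun r => r / d - 1) S := by
    intro r hr s hs hrs
    simp only at hrs
    rw [hS r hr, hS s hs, hrs]
  obtain ⟨M, hM⟩ := (S.image fun r => r / d - 1).exists_nat_subset_range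
  calc ∑ r ∈ S, (q.gcd r : ℝ) * (r : ℝ) ^ (-(1 + ω))
      ≤ ∑ r ∈ S, (((r / d - 1) + 1 : ℕ) : ℝ) ^ (-(1 + ω)) := by
        refine Finset.sum_le_sum fun r hr => ?_
        rw [(Finset.mem_filter.1 hr).2]
        have h1 : (r : ℝ) = d * ((r / d - 1) + 1 : ℕ) := by exact_mod_cast hS r hr
        have h2 : (d : ℝ) * (r : ℝ) ^ (-(1 + ω)) =
            ((d : ℝ) * (d : ℝ) ^ (-(1 + ω))) * (((r / d - 1) + 1 : ℕ) : ℝ) ^ (-(1 + ω)) := by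
          conv_lhs => rw [h1]
          rw [Real.mul_rpow (by positivity) (by positivity)]; ring
        rw [h2]
        refine mul_le_of_le_one_left (by positivity) ?_
        calc (d : ℝ) * (d : ℝ) ^ (-(1 + ω)) = (d : ℝ) ^ (-ω) := by
              rw [mul_comm, ← Real.rpow_add_one (by positivity)]; congr 1; ring
          _ ≤ 1 := Real.rpow_le_one_of_one_le_of_nonpos hdR (by linarith)
    _ = ∑ m ∈ S.image (fun r => r / d - 1), ((m + 1 : ℕ) : ℝ) ^ (-(1 + ω)) :=
        (Finset.sum_image (f := fun m : ℕ => ((m + 1 : ℕ) : ℝ) ^ (-(1 + ω))) hinj).symm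
    _ ≤ ∑ m ∈ Finset.range M, ((m + 1 : ℕ) : ℝ) ^ (-(1 + ω)) :=
        Finset.sum_le_sum_of_subset_of_nonneg hM fun _ _ _ => by positivity
    _ ≤ _ := sum_range_rpow_le hω M

/-- The contribution of `r ≥ q ^ (1 + κ)`. -/
theorem sum_excess_far_le (hκ : 0 < κ) (hκ1 : κ ≤ 1) (hω : 0 < ω) (hωκ : ω ≤ κ / 8) {Cτ : ℝ}
    (hCτ : 0 < Cτ) (hτ : ∀ n : ℕ, n ≠ 0 → (n.divisors.card : ℝ) ≤ Cτ * (n : ℝ) ^ (κ / 8))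
    (hΨ : IsTruncated β γ' ω B Ψ) (he : IsExcess γ Ψ e) {q : ℕ} (hq : IsLarge c B κ κ' q)
    (hq0 : Ψ q ≠ 0) (T : Finset ℕ) (hT : ∀ r ∈ T, q < r ∧ (q : ℝ) ^ (1 + κ) ≤ r) :
    ∑ r ∈ T, e q r ≤ 2 * Cτ * (1 + 1 / ω) * Ψ q := by
  have hqR := hq.one_lt
  have hqR0 : (0 : ℝ) < q := by linarith
  have h1 : ∀ r ∈ T, e q r ≤ 2 * ((q : ℝ) ^ (1 + κ)) ^ (-1 + 2 * ω) *
      ((q.gcd r : ℝ) * (r : ℝ) ^ (-(1 + ω))) := by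
    intro r hr
    obtain ⟨h1, h2⟩ := hT r hr
    have hr0 : 0 < r := by omega
    have hrR : (0 : ℝ) < r := by exact_mod_cast hr0
    have h3 := hΨ.le_rpow hq h1.le
    have h4 := he.le_right q r hq.pos hr0
    have h5 : (r : ℝ) ^ (-1 + 2 * ω) ≤ ((q : ℝ) ^ (1 + κ)) ^ (-1 + 2 * ω) :=
      Real.rpow_le_rpow_of_nonpos (by positivity) h2 (by linarith)
    calc e q r ≤ 2 * q.gcd r * Ψ r / r := h4
      _ ≤ 2 * q.gcd r * (r : ℝ) ^ (-1 + ω) / r := by gcongr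
      _ = 2 * (r : ℝ) ^ (-1 + 2 * ω) * ((q.gcd r : ℝ) * (r : ℝ) ^ (-(1 + ω))) := by
        rw [mul_div_assoc, ← Real.rpow_sub_one hrR.ne',
          show -1 + ω - 1 = (-1 + 2 * ω) + (-(1 + ω)) by ring, Real.rpow_add hrR]
        ring
      _ ≤ _ := by gcongr
  have h2 := sum_gcd_mul_rpow_le (ω := ω) hq.pos.ne' hω T fun r hr => by
    have := (hT r hr).1; omega
  -- The truncation gives Ψ(q) ≥ q^(-(1+κ/8)), and ω ≤ κ/8 makes (1+κ)(-1+2ω) + κ/8 smaller than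
  -- that exponent.
  have h3 : ((q : ℝ) ^ (1 + κ)) ^ (-1 + 2 * ω) * (q : ℝ) ^ (κ / 8) ≤ Ψ q := by
    have h4 := hΨ.one_le q hq0
    have h5 : (q : ℝ) * Real.log q ^ 3 ≤ (q : ℝ) ^ (1 + κ / 8) := by
      rw [Real.rpow_add hqR0, Real.rpow_one]
      gcongr
      exact hq.log_pow
    have h6 : 1 ≤ Ψ q * (q : ℝ) ^ (1 + κ / 8) :=
      h4.trans (mul_le_mul_of_nonneg_left h5 (hΨ.nonneg q))
    have h7 : (q : ℝ) ^ (-(1 + κ / 8)) ≤ Ψ q := by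
      rw [Real.rpow_neg hqR0.le, inv_le_iff_one_le_mul₀ (by positivity)]
      linarith
    refine le_trans ?_ h7
    rw [← Real.rpow_mul hqR0.le, ← Real.rpow_add hqR0]
    refine Real.rpow_le_rpow_of_exponent_le hqR.le ?_
    nlinarith
  calc ∑ r ∈ T, e q r ≤ ∑ r ∈ T, 2 * ((q : ℝ) ^ (1 + κ)) ^ (-1 + 2 * ω) *
      ((q.gcd r : ℝ) * (r : ℝ) ^ (-(1 + ω))) := Finset.sum_le_sum h1
    _ = 2 * ((q : ℝ) ^ (1 + κ)) ^ (-1 + 2 * ω) *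
      ∑ r ∈ T, ((q.gcd r : ℝ) * (r : ℝ) ^ (-(1 + ω))) := by rw [Finset.mul_sum]
    _ ≤ 2 * ((q : ℝ) ^ (1 + κ)) ^ (-1 + 2 * ω) * ((Cτ * (q : ℝ) ^ (κ / 8)) * (1 + 1 / ω)) := by
      gcongr
      refine h2.trans ?_
      gcongr
      exact hτ q hq.pos.ne'
    _ = 2 * Cτ * (1 + 1 / ω) * (((q : ℝ) ^ (1 + κ)) ^ (-1 + 2 * ω) * (q : ℝ) ^ (κ / 8)) := by ring
    _ ≤ _ := by gcongr

/-- The contribution of `r < q ^ (1 + κ)` with `gcd(q, r) ≥ q ^ κ'`. -/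
theorem sum_excess_large_gcd_le (hρ : 0 < ρ) (hc : 0 < c)
    (hdio : ∀ n m : ℤ, (n ≠ 0 ∨ m ≠ 0) →
      c * (max |(n : ℝ)| |(m : ℝ)|) ^ (-ρ) ≤ distInt (n * γ + m * β))
    (hκ : 0 < κ) (hκ1 : κ ≤ 1) (hκκ' : κ * (2 * ρ + 2) ≤ κ') (hω : 0 < ω) (hωκ : ω ≤ κ / 8) {Cτ : ℝ}
    (hCτ : 0 < Cτ) (hτ : ∀ n : ℕ, n ≠ 0 → (n.divisors.card : ℝ) ≤ Cτ * (n : ℝ) ^ (κ / 8))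
    (hΨ : IsTruncated β γ' ω B Ψ) (he : IsExcess γ Ψ e) {q : ℕ} (hq : IsLarge c B κ κ' q)
    (T : Finset ℕ)
    (hT : ∀ r ∈ T, q < r ∧ (r : ℝ) ≤ (q : ℝ) ^ (1 + κ) ∧ (q : ℝ) ^ κ' ≤ q.gcd r) :
    ∑ r ∈ T, e q r ≤ 2 * Cτ * (4 / c) ^ (1 / ρ) * Ψ q := by
  have hqR := hq.one_lt
  have hqR0 : (0 : ℝ) < q := by linarith
  have hΨq := hΨ.nonneg q
  set P := T.filter fun r => 0 < e q r
  -- Both rΨ(q) and qΨ(r) are at most q^(2κ) here, and division by the gcd gains q^κ'.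
  set η := 2 * (q : ℝ) ^ (2 * κ - κ') with hη
  have hη0 : 0 < η := by positivity
  have hTP : ∑ r ∈ T, e q r ≤ ∑ r ∈ P, e q r := by
    rw [Finset.sum_filter]
    refine Finset.sum_le_sum fun r _ => ?_
    split_ifs with h
    · exact le_rfl
    · exact not_lt.1 h
  refine hTP.trans ?_
  rw [← Finset.sum_fiberwise_of_maps_to (s := P) (t := q.divisors) (g := fun r => q.gcd r)
    (fun r _ => Nat.mem_divisors.2 ⟨Nat.gcd_dvd_left q r, hq.pos.ne'⟩)]
  -- For fixed d the n = (r-q)/d are distinct and at most q^(1+κ)/d. This 1/d cancels the d in the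
  -- excess bound 2dΨ(q)/q.
  have hfib : ∀ d ∈ q.divisors, ∑ r ∈ P.filter (fun r => q.gcd r = d), e q r ≤
      2 * Ψ q * (q : ℝ) ^ κ * (2 * η / c) ^ (1 / ρ) := by
    intro d hd
    have hd0 : 0 < d := Nat.pos_of_mem_divisors hd
    have hdR : (0 : ℝ) < d := by exact_mod_cast hd0
    have hdq : d ∣ q := Nat.dvd_of_mem_divisors hd
    set F := P.filter (fun r => q.gcd r = d) with hF
    have hmem : ∀ r ∈ F, q < r ∧ (r : ℝ) ≤ (q : ℝ) ^ (1 + κ) ∧ (q : ℝ) ^ κ' ≤ d ∧ 0 < e q r ∧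
        q.gcd r = d ∧ d ∣ r := by
      intro r hr
      obtain ⟨h1, h2⟩ := Finset.mem_filter.1 hr
      obtain ⟨h3, h4⟩ := Finset.mem_filter.1 h1
      obtain ⟨h5, h6, h7⟩ := hT r h3
      rw [h2] at h7
      exact ⟨h5, h6, h7, h4, h2, h2 ▸ Nat.gcd_dvd_right q r⟩
    have hinj : Set.InjOn (fun r => (r - q) / d) F := by
      intro r hr s hs hrs
      obtain ⟨h1, -, -, -, -, h2⟩ := hmem r hr
      obtain ⟨h3, -, -, -, -, h4⟩ := hmem s hs
      have a1 := Nat.div_mul_cancel (Nat.dvd_sub h2 hdq)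
      have a2 := Nat.div_mul_cancel (Nat.dvd_sub h4 hdq)
      simp only at hrs
      rw [hrs] at a1
      omega
    have hcard : (F.card : ℝ) ≤ (q : ℝ) ^ (1 + κ) / d * (2 * η / c) ^ (1 / ρ) := by
      rw [← Finset.card_image_of_injOn hinj]
      refine card_near_le hρ hc hdio hη0 (by positivity) _ ?_
      intro n hn
      obtain ⟨r, hr, rfl⟩ := Finset.mem_image.1 hn
      obtain ⟨h1, h2, h3, h4, h5, h6⟩ := hmem r hr
      have hdvd : d ∣ r - q := Nat.dvd_sub h6 hdq
      refine ⟨Nat.div_pos (Nat.le_of_dvd (by omega) hdvd) hd0, ?_, ?_⟩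
      · rw [Nat.cast_div hdvd hdR.ne']
        gcongr
        rw [Nat.cast_sub h1.le]
        linarith
      · have h7 := he.near q r hq.pos h1 h4
        rw [h5] at h7
        refine h7.le.trans ?_
        have hr0 : (0 : ℝ) < r := by exact_mod_cast hq.pos.trans h1
        have e1 : r * Ψ q ≤ (q : ℝ) ^ (2 * κ) := by
          calc r * Ψ q ≤ (q : ℝ) ^ (1 + κ) * (q : ℝ) ^ (-1 + ω) := by
                gcongr
                exact hΨ.le_rpow hq le_rfl
            _ = (q : ℝ) ^ (κ + ω) := by rw [← Real.rpow_add hqR0]; congr 1; ring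
            _ ≤ _ := Real.rpow_le_rpow_of_exponent_le hqR.le (by linarith)
        have e2 : q * Ψ r ≤ (q : ℝ) ^ (2 * κ) := by
          calc q * Ψ r ≤ r * (r : ℝ) ^ (-1 + ω) :=
                mul_le_mul (by exact_mod_cast h1.le) (hΨ.le_rpow hq h1.le) (hΨ.nonneg r) hr0.le
            _ = (r : ℝ) ^ ω := by rw [mul_comm, ← Real.rpow_add_one hr0.ne']; congr 1; ring
            _ ≤ ((q : ℝ) ^ (1 + κ)) ^ ω := by gcongr
            _ = (q : ℝ) ^ ((1 + κ) * ω) := by rw [← Real.rpow_mul hqR0.le]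
            _ ≤ _ := Real.rpow_le_rpow_of_exponent_le hqR.le (by nlinarith)
        calc r / d * Ψ q + q / d * Ψ r = (r * Ψ q + q * Ψ r) / d := by ring
          _ ≤ ((q : ℝ) ^ (2 * κ) + (q : ℝ) ^ (2 * κ)) / (q : ℝ) ^ κ' := by gcongr
          _ = η := by rw [hη, Real.rpow_sub hqR0]; ring
    calc ∑ r ∈ F, e q r ≤ ∑ r ∈ F, 2 * d * Ψ q / q := by
          refine Finset.sum_le_sum fun r hr => ?_
          obtain ⟨h1, h2, h3, h4, h5, h6⟩ := hmem r hr
          have := he.le_left q r hq.pos (by omega)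
          rwa [h5] at this
      _ = F.card * (2 * d * Ψ q / q) := by rw [Finset.sum_const, nsmul_eq_mul]
      _ ≤ ((q : ℝ) ^ (1 + κ) / d * (2 * η / c) ^ (1 / ρ)) * (2 * d * Ψ q / q) := by gcongr
      _ = _ := by
        rw [Real.rpow_add hqR0, Real.rpow_one]; field_simp
  refine (Finset.sum_le_sum hfib).trans ?_
  rw [Finset.sum_const, nsmul_eq_mul]
  have h8 : (2 * η / c) ^ (1 / ρ) = (4 / c) ^ (1 / ρ) * (q : ℝ) ^ ((2 * κ - κ') / ρ) := by
    rw [hη, show 2 * (2 * (q : ℝ) ^ (2 * κ - κ')) / c = 4 / c * (q : ℝ) ^ (2 * κ - κ') by ring,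
      Real.mul_rpow (by positivity) (by positivity), ← Real.rpow_mul hqR0.le]
    congr 2; ring
  -- The hypothesis κ(2ρ+2) ≤ κ' gives a saving of q^(-2κ), which beats q^κ from the range of r and
  -- q^(κ/8) from the number of divisors.
  have h9 : (q : ℝ) ^ (κ / 8) * (q : ℝ) ^ κ * (q : ℝ) ^ ((2 * κ - κ') / ρ) ≤ 1 := by
    rw [← Real.rpow_add hqR0, ← Real.rpow_add hqR0]
    refine Real.rpow_le_one_of_one_le_of_nonpos hqR.le ?_
    have : (2 * κ - κ') / ρ ≤ -(2 * κ) := by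
      rw [div_le_iff₀ hρ]; linarith
    linarith
  calc (q.divisors.card : ℝ) * (2 * Ψ q * (q : ℝ) ^ κ * (2 * η / c) ^ (1 / ρ))
      ≤ (Cτ * (q : ℝ) ^ (κ / 8)) * (2 * Ψ q * (q : ℝ) ^ κ * (2 * η / c) ^ (1 / ρ)) := by
        gcongr
        exact hτ q hq.pos.ne'
    _ = 2 * Cτ * (4 / c) ^ (1 / ρ) * Ψ q *
        ((q : ℝ) ^ (κ / 8) * (q : ℝ) ^ κ * (q : ℝ) ^ ((2 * κ - κ') / ρ)) := by rw [h8]; ring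
    _ ≤ 2 * Cτ * (4 / c) ^ (1 / ρ) * Ψ q * 1 := by gcongr
    _ = _ := mul_one _

end Bounds

/-! ### Excess from one dyadic box with small gcd. -/

theorem sum_ite_mem_le_card_mul {α : Type*} [DecidableEq α] (F : Finset α) (g : α → ℕ)
    (hg : Set.InjOn g F) (S : Finset ℕ) {A : ℝ} (hA : 0 ≤ A) :
    ∑ r ∈ F, (if g r ∈ S then A else 0) ≤ S.card * A := by
  rw [← Finset.sum_filter, Finset.sum_const, nsmul_eq_mul]
  gcongr
  refine Finset.card_le_card_of_injOn g (fun r hr => (Finset.mem_filter.1 hr).2) ?_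
  exact hg.mono fun r hr => (Finset.mem_filter.1 hr).1

section Box

variable {γ β γ' ρ c B ω κ κ' : ℝ} {Ψ : ℕ → ℝ} {e : ℕ → ℕ → ℝ}

/-- The error in `card_box_le` is at most q^(κ'+5κ'ρ), while the main term is at least q^(1-6κ').
The condition on κ' is exactly what absorbs the former, raising 2304 to 2305. -/
theorem card_box_le_of_isLarge (hρ : 0 < ρ) (hc : 0 < c)
    (hdio : ∀ n m : ℤ, (n ≠ 0 ∨ m ≠ 0) →
      c * (max |(n : ℝ)| |(m : ℝ)|) ^ (-ρ) ≤ distInt (n * γ + m * β))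
    (hκ' : 0 < κ') (hκρ : 5 * κ' * ρ + 7 * κ' ≤ 1) {q : ℕ} (hq : IsLarge c B κ κ' q)
    {d N : ℕ} (hd : 1 ≤ d) (hdq : (d : ℝ) ≤ (q : ℝ) ^ κ') (hN : (q : ℝ) ^ (1 - κ') ≤ N)
    {η₁ η₂ : ℝ} (h1 : (q : ℝ) ^ (-(4 * κ')) ≤ η₁) (h2 : (q : ℝ) ^ (-κ') ≤ η₂)
    (h1' : η₁ ≤ 1) (h2' : η₂ ≤ 1) (α : ℝ) :
    (((Finset.range N).filter fun n : ℕ =>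
        distInt (n * γ) ≤ η₁ ∧ distInt (n * (d * β) + α) ≤ η₂).card : ℝ) ≤
      2305 * (N * η₁ * η₂) := by
  have hqR := hq.one_lt
  have hqR0 : (0 : ℝ) < q := by linarith
  have h0 : 0 < (q : ℝ) ^ (-(4 * κ')) := by positivity
  have h3 : (q : ℝ) ^ (-(4 * κ')) ≤ η₂ :=
    (Real.rpow_le_rpow_of_exponent_le hqR.le (by linarith)).trans h2
  refine (card_box_le hρ hc hdio hd h0 h1 h3 h1' h2' α).trans ?_
  have h4 : 8 / c * (d / (q : ℝ) ^ (-(4 * κ'))) ^ ρ ≤ N * η₁ * η₂ := by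
    calc 8 / c * (d / (q : ℝ) ^ (-(4 * κ'))) ^ ρ
        ≤ (q : ℝ) ^ κ' * ((q : ℝ) ^ κ' / (q : ℝ) ^ (-(4 * κ'))) ^ ρ := by
          gcongr
          exact hq.const_le
      _ = (q : ℝ) ^ (κ' + 5 * κ' * ρ) := by
          rw [← Real.rpow_sub hqR0, ← Real.rpow_mul hqR0.le, ← Real.rpow_add hqR0]
          congr 1; ring
      _ ≤ (q : ℝ) ^ ((1 - κ') + -(4 * κ') + -κ') :=
          Real.rpow_le_rpow_of_exponent_le hqR.le (by linarith)
      _ = (q : ℝ) ^ (1 - κ') * (q : ℝ) ^ (-(4 * κ')) * (q : ℝ) ^ (-κ') := by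
          rw [Real.rpow_add hqR0, Real.rpow_add hqR0]
      _ ≤ N * η₁ * η₂ := by
          have := h0.trans_le h1
          gcongr
  linarith

/-- With n = (r-q)/d, positive excess forces ‖nγ‖ ≤ u + v, and the shell forces ‖ndβ + (qβ-γ')‖ ≤
2^(-j). Counting such n costs a factor 2^(-j), which cancels the 2^j in the bound v₀ for Ψ on the
box; the size 2^i cancels too, so the result depends on neither i nor j. -/
theorem sum_excess_box_le (hρ : 0 < ρ) (hc : 0 < c) (hB : 1 ≤ B)
    (hdio : ∀ n m : ℤ, (n ≠ 0 ∨ m ≠ 0) →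
      c * (max |(n : ℝ)| |(m : ℝ)|) ^ (-ρ) ≤ distInt (n * γ + m * β))
    (hκ : 0 < κ) (hκ1 : κ ≤ 1) (hκκ' : κ ≤ κ') (hκρ : 5 * κ' * ρ + 7 * κ' ≤ 1)
    (hω : 0 < ω) (hωκ : ω ≤ κ / 8)
    (hΨ : IsTruncated β γ' ω B Ψ) (he : IsExcess γ Ψ e) {q : ℕ} (hq : IsLarge c B κ κ' q)
    (hq0 : Ψ q ≠ 0) {d : ℕ} (hdq : d ∣ q) (hd : (d : ℝ) ≤ (q : ℝ) ^ κ') (i j : ℕ) (F : Finset ℕ)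
    (hF : ∀ r ∈ F, q < r ∧ (r : ℝ) ≤ (q : ℝ) ^ (1 + κ) ∧ q.gcd r = d ∧ Ψ r ≠ 0 ∧
      2 ^ i * q ≤ r ∧ r < 2 ^ (i + 1) * q ∧
      1 ≤ 2 ^ (j + 1) * distInt (r * β - γ') ∧ 2 ^ j * distInt (r * β - γ') ≤ 1) :
    ∑ r ∈ F, e q r ≤
      110640 * B * Ψ q / (d * (Real.log q * Real.log (Real.log q) ^ 2)) := by
  have hqR := hq.one_lt
  have hqR0 : (0 : ℝ) < q := by linarith
  have hqpos := hq.pos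
  have hκ'0 : 0 < κ' := by linarith
  have hd0 : 0 < d := Nat.pos_of_dvd_of_pos hdq hq.pos
  have hdR : (0 : ℝ) < d := by exact_mod_cast hd0
  have hΨq : 0 < Ψ q := lt_of_le_of_ne (hΨ.nonneg q) (Ne.symm hq0)
  have hW0 := hq.weight_pos
  have hWle := hq.weight_le
  have hWmono : ∀ r, q ≤ r → _ := fun r => hq.weight_mono (r := r)
  set W := Real.log q * Real.log (Real.log q) ^ 2
  rcases F.eq_empty_or_nonempty with rfl | hne
  · simp only [Finset.sum_empty]
    positivity
  set x : ℝ := 2 ^ j with hx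
  have hx1 : 1 ≤ x := one_le_pow₀ one_le_two
  set R : ℝ := 2 ^ i * q with hR
  have hR0 : 0 < R := by positivity
  have hqR' : (q : ℝ) ≤ R := le_mul_of_one_le_left hqR0.le (one_le_pow₀ one_le_two)
  have hRle : R ≤ (q : ℝ) ^ (1 + κ) := by
    obtain ⟨r, hr⟩ := hne
    have h := hF r hr
    refine le_trans ?_ h.2.1
    rw [hR]; exact_mod_cast h.2.2.2.2.1
  -- The lower bound ‖rβ-γ'‖ ≥ r^(-ω) with small ω keeps the shell wide enough for the box count.
  have hxle : (q : ℝ) ^ (-κ') ≤ 1 / x := by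
    obtain ⟨r, hr⟩ := hne
    obtain ⟨h1, h2, -, h4, -, -, -, h8⟩ := hF r hr
    have hr0 : (0 : ℝ) < r := by exact_mod_cast hq.pos.trans h1
    have h9 := hΨ.rpow_le r h4
    rw [le_div_iff₀ (by positivity), mul_comm]
    refine le_trans ?_ h8
    gcongr
    refine le_trans ?_ h9
    calc (q : ℝ) ^ (-κ') ≤ ((q : ℝ) ^ (1 + κ)) ^ (-ω) := by
          rw [← Real.rpow_mul hqR0.le]
          exact Real.rpow_le_rpow_of_exponent_le hqR.le (by nlinarith)
      _ ≤ _ := Real.rpow_le_rpow_of_nonpos hr0 h2 (by linarith)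
  set N : ℕ := 2 ^ (i + 1) * (q / d) with hN
  have hNR : (N : ℝ) = 2 * R / d := by
    rw [hN, hR]; push_cast; rw [Nat.cast_div hdq hdR.ne']; ring
  have hNge : (q : ℝ) ^ (1 - κ') ≤ N := by
    rw [hNR, Real.rpow_sub hqR0, Real.rpow_one]
    gcongr
    linarith
  set v₀ := 2 * B * x / (R * W) with hv₀
  have hv₀0 : 0 < v₀ := by positivity
  have hΨr : ∀ r ∈ F, Ψ r ≤ v₀ := by
    intro r hr
    obtain ⟨h1, h2, -, h4, h5, -, h7, -⟩ := hF r hr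
    have h9 := hΨ.mul_le r h4
    have hR' : R ≤ r := by rw [hR]; exact_mod_cast h5
    have hp := hΨ.nonneg r
    have hW' := hWmono r h1.le
    have h7' : 1 / (2 * x) ≤ distInt (r * β - γ') := by
      rw [div_le_iff₀ (by positivity)]
      rw [pow_succ] at h7
      linarith
    have h10 : Ψ r * (1 / (2 * x)) * (R * W) ≤ B := by
      refine le_trans ?_ h9
      have := distInt_nonneg (r * β - γ')
      gcongr
    rw [hv₀, le_div_iff₀ (by positivity)]
    have h11 : Ψ r * (1 / (2 * x)) * (R * W) * (2 * x) ≤ B * (2 * x) := by gcongr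
    calc Ψ r * (R * W) = Ψ r * (1 / (2 * x)) * (R * W) * (2 * x) := by field_simp
      _ ≤ B * (2 * x) := h11
      _ = _ := by ring
  set u := 2 * R / d * Ψ q with hu
  set v := q / d * v₀ with hv
  have hu0 : 0 < u := by positivity
  have hv0 : 0 < v := by positivity
  set S : ℝ → Finset ℕ := fun η => (Finset.range N).filter fun n : ℕ =>
        distInt (n * γ) ≤ min 1 η ∧ distInt (n * (d * β) + (q * β - γ')) ≤ 1 / x with hS
  have hcard : ∀ η, (q : ℝ) ^ (-(4 * κ')) ≤ η → ((S η).card : ℝ) ≤ 2305 * (N * η * (1 / x)) := by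
    intro η hη
    have h4 : (q : ℝ) ^ (-(4 * κ')) ≤ 1 :=
      Real.rpow_le_one_of_one_le_of_nonpos hqR.le (by linarith)
    refine (card_box_le_of_isLarge hρ hc hdio hκ'0 hκρ hq hd0 hd hNge (le_min h4 hη) hxle
      (min_le_left _ _) ?_ _).trans ?_
    · rw [div_le_one (by positivity)]; exact hx1
    · gcongr
      exact min_le_right _ _
  -- The lower bound Ψ(q) ≥ 1/(q log³ q) keeps the γ-side of the box above the admissible scale.
  have hSu : (q : ℝ) ^ (-(4 * κ')) ≤ 2 * u := by
    have h4 := hΨ.one_le q hq0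
    have h5 : 1 ≤ R * Ψ q * (q : ℝ) ^ (κ / 8) := by
      calc 1 ≤ Ψ q * (q * Real.log q ^ 3) := h4
        _ ≤ Ψ q * (R * (q : ℝ) ^ (κ / 8)) := by
          have := hq.log_pow
          have := hq.log_pos
          gcongr
        _ = _ := by ring
    have h6 : (q : ℝ) ^ (-(4 * κ')) ≤ (q : ℝ) ^ (-(κ / 8)) / (q : ℝ) ^ κ' := by
      rw [← Real.rpow_sub hqR0]
      exact Real.rpow_le_rpow_of_exponent_le hqR.le (by linarith)
    have h7 : (q : ℝ) ^ (-(κ / 8)) ≤ R * Ψ q := by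
      rw [Real.rpow_neg hqR0.le, inv_le_iff_one_le_mul₀ (by positivity)]
      linarith
    calc _ ≤ (q : ℝ) ^ (-(κ / 8)) / (q : ℝ) ^ κ' := h6
      _ ≤ R * Ψ q / d := by gcongr
      _ ≤ 4 * (R * Ψ q / d) := by
        have : 0 ≤ R * Ψ q / d := by positivity
        linarith
      _ = 2 * u := by rw [hu]; ring
  have hSv : (q : ℝ) ^ (-(4 * κ')) ≤ 2 * v := by
    have h6 : (q : ℝ) ^ (-(4 * κ')) ≤
        q / ((q : ℝ) ^ κ' * ((q : ℝ) ^ (1 + κ) * (q : ℝ) ^ (κ / 8))) := by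
      rw [← Real.rpow_add hqR0, ← Real.rpow_add hqR0, ← Real.rpow_one_sub' hqR0.le (by linarith)]
      exact Real.rpow_le_rpow_of_exponent_le hqR.le (by linarith)
    calc _ ≤ q / ((q : ℝ) ^ κ' * ((q : ℝ) ^ (1 + κ) * (q : ℝ) ^ (κ / 8))) := h6
      _ ≤ q / (d * (R * W)) := by gcongr
      _ ≤ 4 * B * x * (q / (d * (R * W))) := by
        refine le_mul_of_one_le_left (by positivity) ?_
        nlinarith
      _ = 2 * v := by rw [hv, hv₀]; field_simp; norm_num
  have hmem : ∀ r ∈ F, d ∣ r - q ∧ q < r := by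
    intro r hr
    obtain ⟨h1, -, h3, -⟩ := hF r hr
    exact ⟨Nat.dvd_sub (h3 ▸ Nat.gcd_dvd_right q r) hdq, h1⟩
  have hinj : Set.InjOn (fun r => (r - q) / d) F := by
    intro r hr s hs hrs
    obtain ⟨h1, h2⟩ := hmem r hr
    obtain ⟨h3, h4⟩ := hmem s hs
    have a1 := Nat.div_mul_cancel h1
    have a2 := Nat.div_mul_cancel h3
    simp only at hrs
    rw [hrs] at a1
    omega
  have hterm : ∀ r ∈ F, e q r ≤ (if (r - q) / d ∈ S (2 * u) then 2 * d * v₀ / R else 0) +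
      (if (r - q) / d ∈ S (2 * v) then 2 * d * Ψ q / q else 0) := by
    intro r hr
    have hA : 0 ≤ 2 * d * v₀ / R := by positivity
    have hA' : 0 ≤ 2 * d * Ψ q / q := by positivity
    have hnn : ∀ (p p' : Prop) [Decidable p] [Decidable p'],
        0 ≤ (if p then 2 * d * v₀ / R else 0) + (if p' then 2 * d * Ψ q / q else 0) := by
      intro p p' _ _
      split_ifs <;> linarith
    by_cases hepos : e q r ≤ 0
    · exact hepos.trans (hnn _ _)
    rw [not_le] at hepos
    obtain ⟨h1, h2, h3, h4, h5, h6, h7, h8⟩ := hF r hr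
    have hdvd := (hmem r hr).1
    have hRr : R ≤ r := by rw [hR]; exact_mod_cast h5
    have hrR : (r : ℝ) ≤ 2 * R := by
      have h : (r : ℝ) ≤ 2 ^ (i + 1) * q := by exact_mod_cast h6.le
      rw [hR]; rw [pow_succ] at h; linarith
    have hnear := he.near q r hq.pos h1 hepos
    have hl := he.le_left q r hq.pos (by omega)
    have hr' := he.le_right q r hq.pos (by omega)
    rw [h3] at hnear hl hr'
    have hΨr0 := hΨr r hr
    have hΨnn := hΨ.nonneg r
    have hsum : distInt (((r - q) / d : ℕ) * γ) ≤ u + v := by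
      refine hnear.le.trans ?_
      rw [hu, hv]
      gcongr
    have hN' : (r - q) / d < N := by
      obtain ⟨m, hm⟩ := hdq
      have hm' : q / d = m := by rw [hm]; exact Nat.mul_div_cancel_left m hd0
      rw [hN, hm']
      refine Nat.div_lt_of_lt_mul ?_
      calc r - q < 2 ^ (i + 1) * q := by omega
        _ = _ := by rw [hm]; ring
    have hnd : (((r - q) / d : ℕ) : ℝ) * d = r - q := by
      rw [Nat.cast_div hdvd hdR.ne', div_mul_cancel₀ _ hdR.ne', Nat.cast_sub h1.le]
    have hbeta : distInt (((r - q) / d : ℕ) * (d * β) + (q * β - γ')) ≤ 1 / x := by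
      have e1 : (((r - q) / d : ℕ) : ℝ) * (d * β) + (q * β - γ') = r * β - γ' := by
        rw [← mul_assoc, hnd]; ring
      rw [e1, le_div_iff₀ (by positivity)]
      linarith
    have hone : distInt (((r - q) / d : ℕ) * γ) ≤ 1 := (distInt_le_half _).trans (by norm_num)
    -- The dominant one of u and v decides which excess bound to use: u carries Ψ(q) and is paired
    -- with the bound in v₀, while v carries v₀ and is paired with the bound in Ψ(q). Each product
    -- then contains Ψ(q)v₀ once.
    rcases le_total v u with huv | huv
    · have hin : (r - q) / d ∈ S (2 * u) := by
        rw [hS]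
        exact Finset.mem_filter.2 ⟨Finset.mem_range.2 hN', le_min hone (by linarith), hbeta⟩
      rw [if_pos hin]
      have h9 : e q r ≤ 2 * d * v₀ / R := by
        refine hr'.trans ?_
        gcongr
      split_ifs <;> linarith
    · have hin : (r - q) / d ∈ S (2 * v) := by
        rw [hS]
        exact Finset.mem_filter.2 ⟨Finset.mem_range.2 hN', le_min hone (by linarith), hbeta⟩
      rw [if_pos hin]
      split_ifs <;> linarith
  have hA : 0 ≤ 2 * d * v₀ / R := by positivity
  have hA' : 0 ≤ 2 * d * Ψ q / q := by positivity
  calc ∑ r ∈ F, e q r ≤ ((S (2 * u)).card : ℝ) * (2 * d * v₀ / R) +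
        (S (2 * v)).card * (2 * d * Ψ q / q) := by
        refine (Finset.sum_le_sum hterm).trans ?_
        rw [Finset.sum_add_distrib]
        exact add_le_add (sum_ite_mem_le_card_mul F _ hinj _ hA)
          (sum_ite_mem_le_card_mul F _ hinj _ hA')
    _ ≤ 2305 * (N * (2 * u) * (1 / x)) * (2 * d * v₀ / R) +
        2305 * (N * (2 * v) * (1 / x)) * (2 * d * Ψ q / q) := by
        gcongr
        · exact hcard _ hSu
        · exact hcard _ hSv
    _ = _ := by
        rw [hNR, hu, hv, hv₀]
        field_simp
        norm_num

end Box

/-- Every `0 < D ≤ 1` lies in a dyadic shell. -/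
theorem exists_shell {D : ℝ} (hD : 0 < D) (hD1 : D ≤ 1) :
    1 ≤ 2 ^ (Nat.log 2 ⌊1 / D⌋₊ + 1) * D ∧ (2 : ℝ) ^ Nat.log 2 ⌊1 / D⌋₊ * D ≤ 1 := by
  have h1 : 1 ≤ ⌊1 / D⌋₊ := Nat.le_floor (by rw [Nat.cast_one, one_le_div hD]; exact hD1)
  have h2 := Nat.pow_log_le_self 2 (show ⌊1 / D⌋₊ ≠ 0 by omega)
  have h3 := Nat.lt_pow_succ_log_self one_lt_two ⌊1 / D⌋₊
  constructor
  · rw [← div_le_iff₀ hD]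
    have h4 : (⌊1 / D⌋₊ : ℝ) + 1 ≤ 2 ^ (Nat.log 2 ⌊1 / D⌋₊ + 1) := by exact_mod_cast h3
    exact (Nat.lt_floor_add_one (1 / D)).le.trans h4
  · rw [← le_div_iff₀ hD]
    have h4 : (2 : ℝ) ^ Nat.log 2 ⌊1 / D⌋₊ ≤ (⌊1 / D⌋₊ : ℝ) := by exact_mod_cast h2
    exact h4.trans (Nat.floor_le (by positivity))

theorem sum_range_two_rpow_le {ε : ℝ} (hε : 0 < ε) (hε1 : ε ≤ 1) (I : ℕ) :
    ∑ i ∈ Finset.range I, ((2 : ℝ) ^ (-ε)) ^ i ≤ 4 / ε := by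
  have hl := Real.log_two_gt_d9
  have hl' := Real.log_two_lt_d9
  have h1 : (2 : ℝ) ^ (-ε) ≤ 1 - ε / 4 := by
    have h2 : (2 : ℝ) ^ (-ε) = (Real.exp (ε * Real.log 2))⁻¹ := by
      rw [Real.rpow_def_of_pos two_pos, ← Real.exp_neg]; congr 1; ring
    have h3 := Real.add_one_le_exp (ε * Real.log 2)
    have h5 : 1 + ε / 2 ≤ Real.exp (ε * Real.log 2) := by nlinarith
    rw [h2, inv_le_iff_one_le_mul₀ (by positivity)]
    have h6 : (0 : ℝ) ≤ 1 - ε / 4 := by linarith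
    nlinarith
  have h0 : (0 : ℝ) ≤ (2 : ℝ) ^ (-ε) := by positivity
  have hlt : (2 : ℝ) ^ (-ε) < 1 := by linarith
  have h2 := (summable_geometric_of_lt_one h0 hlt).sum_le_tsum (Finset.range I)
    (fun i _ => pow_nonneg h0 i)
  rw [tsum_geometric_of_lt_one h0 hlt] at h2
  refine h2.trans ?_
  rw [inv_le_iff_one_le_mul₀ (by linarith), div_mul_eq_mul_div, one_le_div hε]
  linarith

/-! ### Summation over boxes by Rankin's trick. -/

section Total

variable {γ β γ' ρ c B ω κ κ' K : ℝ} {Ψ : ℕ → ℝ} {e : ℕ → ℕ → ℝ}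

/-- The contribution of `r ≤ q ^ (1 + κ)` with `gcd(q, r) ≤ q ^ κ'`. -/
theorem sum_excess_small_gcd_le (hρ : 0 < ρ) (hc : 0 < c) (hB : 1 ≤ B)
    (hdio : ∀ n m : ℤ, (n ≠ 0 ∨ m ≠ 0) →
      c * (max |(n : ℝ)| |(m : ℝ)|) ^ (-ρ) ≤ distInt (n * γ + m * β))
    (hκ : 0 < κ) (hκ1 : κ ≤ 1) (hκκ' : κ ≤ κ') (hκρ : 5 * κ' * ρ + 7 * κ' ≤ 1)
    (hω : 0 < ω) (hωκ : ω ≤ κ / 8) (hK : 1 ≤ K) {Cσ : ℝ} (hCσ : 0 < Cσ)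
    (hσ : ∀ q : ℕ, 3 ≤ Real.log (Real.log q) →
      ∑ d ∈ q.divisors, (d : ℝ) ^ (-(1 - 1 / Real.log (Real.log q))) ≤
        Cσ * Real.log (Real.log q))
    (hΨ : IsTruncated β γ' ω B Ψ) (he : IsExcess γ Ψ e) {q : ℕ} (hq : IsLarge c B κ κ' q)
    (hq0 : Ψ q ≠ 0) (T : Finset ℕ)
    (hT : ∀ r ∈ T, q < r ∧ (r : ℝ) ≤ (q : ℝ) ^ (1 + κ) ∧ (q.gcd r : ℝ) ≤ (q : ℝ) ^ κ' ∧
      Ψ r ≠ 0 ∧ r * Ψ q < K * q.gcd r) :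
    ∑ r ∈ T, e q r ≤ 885120 * Real.exp 3 * B * K * Cσ * Ψ q := by
  have hqR := hq.one_lt
  have hqR0 : (0 : ℝ) < q := by linarith
  have hqpos := hq.pos
  have hΨq : 0 < Ψ q := lt_of_le_of_ne (hΨ.nonneg q) (Ne.symm hq0)
  have hlog := hq.log_pos
  have hll := hq.loglog
  set L := Real.log q with hL
  set LL := Real.log L with hLL
  have hLL0 : 0 < LL := by linarith
  -- Rankin's exponent: L^(3ε) = e³ stays bounded, while the sums over i and over d each cost only a
  -- multiple of LL.
  set ε := 1 / LL with hε
  have hε0 : 0 < ε := by positivity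
  have hε1 : ε ≤ 1 := by rw [hε, div_le_one hLL0]; linarith
  have hD : ∀ r ∈ T, 0 < distInt (r * β - γ') := by
    intro r hr
    obtain ⟨h1, h2, h3, h4, h5⟩ := hT r hr
    have hr0 : (0 : ℝ) < r := by exact_mod_cast hq.pos.trans h1
    exact lt_of_lt_of_le (by positivity) (hΨ.rpow_le r h4)
  have hshell : ∀ r ∈ T, _ := fun r hr =>
    exists_shell (hD r hr) ((distInt_le_half _).trans (by norm_num))
  set g : ℕ → ℕ × ℕ × ℕ := fun r =>
    (q.gcd r, Nat.log 2 (r / q), Nat.log 2 ⌊1 / distInt (r * β - γ')⌋₊) with hg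
  -- A crude bound on the size index suffices, since the Rankin weights form a convergent geometric
  -- series; only the number J of shells enters the final bound.
  set I := T.sup id + 1 with hI
  set J := ⌊L⌋₊ + 1 with hJ
  have hJle : (J : ℝ) ≤ 2 * L := by
    have := Nat.floor_le hlog.le
    have := hq.four_le_log
    rw [hJ]; push_cast; linarith
  have hmaps : ∀ r ∈ T, g r ∈ q.divisors ×ˢ Finset.range I ×ˢ Finset.range J := by
    intro r hr
    obtain ⟨h1, h2, h3, h4, h5⟩ := hT r hr
    have hr0 : (0 : ℝ) < r := by exact_mod_cast hq.pos.trans h1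
    simp only [hg, Finset.mem_product, Finset.mem_range]
    refine ⟨Nat.mem_divisors.2 ⟨Nat.gcd_dvd_left q r, hq.pos.ne'⟩, ?_, ?_⟩
    · rw [hI]
      have a1 : Nat.log 2 (r / q) ≤ r := (Nat.log_le_self _ _).trans (Nat.div_le_self _ _)
      have a2 : r ≤ T.sup id := Finset.le_sup (f := id) hr
      omega
    · rw [hJ, Nat.lt_succ_iff]
      apply Nat.le_floor
      have h6 := (hshell r hr).2
      set j := Nat.log 2 ⌊1 / distInt (r * β - γ')⌋₊
      have h7 := hΨ.rpow_le r h4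
      have h8 : (2 : ℝ) ^ j ≤ (r : ℝ) ^ ω := by
        rw [Real.rpow_neg hr0.le, inv_le_iff_one_le_mul₀ (by positivity)] at h7
        have h9 : (0 : ℝ) < 2 ^ j := by positivity
        have := hD r hr
        have h10 : 0 < (r : ℝ) ^ ω := by positivity
        refine le_of_mul_le_mul_right (h6.trans (h7.trans_eq (mul_comm _ _))) this
      have h9 : (2 : ℝ) ^ j ≤ (q : ℝ) ^ (1 / 2 : ℝ) := by
        calc (2 : ℝ) ^ j ≤ (r : ℝ) ^ ω := h8
          _ ≤ ((q : ℝ) ^ (1 + κ)) ^ ω := by gcongr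
          _ = (q : ℝ) ^ ((1 + κ) * ω) := by rw [← Real.rpow_mul hqR0.le]
          _ ≤ _ := Real.rpow_le_rpow_of_exponent_le hqR.le (by nlinarith)
      have h10 := Real.log_le_log (by positivity) h9
      rw [Real.log_pow, Real.log_rpow hqR0, ← hL] at h10
      have := Real.log_two_gt_d9
      have hj0 : (0 : ℝ) ≤ j := Nat.cast_nonneg j
      nlinarith
  rw [← Finset.sum_fiberwise_of_maps_to hmaps]
  have hfib : ∀ t ∈ q.divisors ×ˢ Finset.range I ×ˢ Finset.range J,
      ∑ r ∈ T.filter (fun r => g r = t), e q r ≤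
        110640 * B * Ψ q / (L * LL ^ 2) * (K * Real.exp 3) *
          ((t.1 : ℝ) ^ (-(1 - ε)) * ((2 : ℝ) ^ (-ε)) ^ t.2.1) := by
    rintro ⟨d, i, j⟩ ht
    simp only [Finset.mem_product] at ht
    have hdq : d ∣ q := Nat.dvd_of_mem_divisors ht.1
    have hd0 : 0 < d := Nat.pos_of_mem_divisors ht.1
    have hdR : (0 : ℝ) < d := by exact_mod_cast hd0
    set F := T.filter (fun r => g r = (d, i, j)) with hFdef
    have hmemF : ∀ r ∈ F, r ∈ T ∧ q.gcd r = d ∧ Nat.log 2 (r / q) = i ∧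
        Nat.log 2 ⌊1 / distInt (r * β - γ')⌋₊ = j := by
      intro r hr
      obtain ⟨h1, h2⟩ := Finset.mem_filter.1 hr
      simp only [hg, Prod.mk.injEq] at h2
      exact ⟨h1, h2⟩
    rcases F.eq_empty_or_nonempty with hF0 | ⟨s, hs⟩
    · rw [hF0, Finset.sum_empty]
      positivity
    have hpow : ∀ r ∈ F, 2 ^ i * q ≤ r ∧ r < 2 ^ (i + 1) * q := by
      intro r hr
      obtain ⟨h1, h2, h3, h4⟩ := hmemF r hr
      have h5 := (hT r h1).1
      have h6 : r / q ≠ 0 := (Nat.div_pos h5.le hq.pos).ne'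
      have h7 := Nat.pow_log_le_self 2 h6
      have h8 := Nat.lt_pow_succ_log_self one_lt_two (r / q)
      rw [h3] at h7 h8
      exact ⟨(Nat.le_div_iff_mul_le hq.pos).1 h7, (Nat.div_lt_iff_lt_mul hq.pos).1 h8⟩
    have hbox := sum_excess_box_le hρ hc hB hdio hκ hκ1 hκκ' hκρ hω hωκ hΨ he hq hq0 hdq
      (by
        obtain ⟨h1, h2, -, -⟩ := hmemF s hs
        have := (hT s h1).2.2.1
        rwa [h2] at this) i j F (by
        intro r hr
        obtain ⟨h1, h2, h3, h4⟩ := hmemF r hr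
        obtain ⟨a1, a2, a3, a4, a5⟩ := hT r h1
        have h5 := hshell r h1
        rw [h4] at h5
        exact ⟨a1, a2, h2, a4, (hpow r hr).1, (hpow r hr).2, h5.1, h5.2⟩)
    -- A nonempty box has 2^i q Ψ(q) < Kd, and Ψ(q) ≥ 1/(qL³), so 2^i ≤ KdL³. Raised to the power ε,
    -- this allows the insertion of a factor at least 1 that decays in i.
    have hrankin : 1 ≤ K * Real.exp 3 * ((d : ℝ) ^ ε * ((2 : ℝ) ^ (-ε)) ^ i) := by
      obtain ⟨h1, h2, h3, h4⟩ := hmemF s hs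
      obtain ⟨a1, a2, a3, a4, a5⟩ := hT s h1
      rw [h2] at a5
      have h5 := hΨ.one_le q hq0
      have h6 : (2 : ℝ) ^ i * q ≤ s := by exact_mod_cast (hpow s hs).1
      have h7 : (2 : ℝ) ^ i ≤ K * d * L ^ 3 := by
        have h8 : (2 : ℝ) ^ i * q * Ψ q ≤ K * d :=
          (mul_le_mul_of_nonneg_right h6 hΨq.le).trans a5.le
        calc (2 : ℝ) ^ i = (2 : ℝ) ^ i * 1 := (mul_one _).symm
          _ ≤ (2 : ℝ) ^ i * (Ψ q * (q * L ^ 3)) := by gcongr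
          _ = (2 : ℝ) ^ i * q * Ψ q * L ^ 3 := by ring
          _ ≤ _ := by gcongr
      have h9 : ((2 : ℝ) ^ i) ^ ε ≤ (K * d * L ^ 3) ^ ε := by gcongr
      have h10 : (K * d * L ^ 3) ^ ε = K ^ ε * d ^ ε * Real.exp 3 := by
        rw [Real.mul_rpow (by positivity) (by positivity), Real.mul_rpow (by positivity)
          (by positivity)]
        congr 1
        rw [Real.rpow_def_of_pos (by positivity), Real.log_pow, ← hLL, hε]
        congr 1; field_simp; norm_num
      have h11 : K ^ ε ≤ K := by
        calc K ^ ε ≤ K ^ (1 : ℝ) := Real.rpow_le_rpow_of_exponent_le hK hε1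
          _ = K := Real.rpow_one K
      have h12 : ((2 : ℝ) ^ (-ε)) ^ i = (((2 : ℝ) ^ i) ^ ε)⁻¹ := by
        rw [← Real.rpow_natCast, ← Real.rpow_natCast, ← Real.rpow_mul (by norm_num),
          ← Real.rpow_mul (by norm_num), ← Real.rpow_neg (by norm_num)]
        congr 1; ring
      rw [h12, ← mul_assoc, ← div_eq_mul_inv, one_le_div (by positivity)]
      rw [h10] at h9
      calc _ ≤ K ^ ε * d ^ ε * Real.exp 3 := h9
        _ ≤ K * d ^ ε * Real.exp 3 := by gcongr
        _ = _ := by ring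
    refine hbox.trans ?_
    have h13 : (d : ℝ) ^ (-(1 - ε)) = d ^ ε / d := by
      rw [show -(1 - ε) = ε - 1 by ring, Real.rpow_sub_one hdR.ne']
    calc 110640 * B * Ψ q / (d * (L * LL ^ 2))
        ≤ 110640 * B * Ψ q / (d * (L * LL ^ 2)) *
          (K * Real.exp 3 * ((d : ℝ) ^ ε * ((2 : ℝ) ^ (-ε)) ^ i)) :=
          le_mul_of_one_le_right (by positivity) hrankin
      _ = _ := by simp only [h13]; field_simp
  refine (Finset.sum_le_sum hfib).trans ?_
  rw [← Finset.mul_sum]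
  have hprod : ∑ t ∈ q.divisors ×ˢ Finset.range I ×ˢ Finset.range J,
      ((t.1 : ℝ) ^ (-(1 - ε)) * ((2 : ℝ) ^ (-ε)) ^ t.2.1) =
      (∑ d ∈ q.divisors, (d : ℝ) ^ (-(1 - ε))) *
        ((∑ i ∈ Finset.range I, ((2 : ℝ) ^ (-ε)) ^ i) * J) := by
    rw [Finset.sum_product, Finset.sum_mul]
    refine Finset.sum_congr rfl fun d _ => ?_
    rw [Finset.sum_product, Finset.sum_mul, Finset.mul_sum]
    refine Finset.sum_congr rfl fun i _ => ?_
    simp only [Finset.sum_const, Finset.card_range, nsmul_eq_mul]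
    ring
  rw [hprod]
  have hs1 := hσ q hll
  have hs2 := sum_range_two_rpow_le hε0 hε1 I
  have hs3 : 4 / ε = 4 * LL := by rw [hε]; field_simp
  rw [hs3] at hs2
  calc _ ≤ 110640 * B * Ψ q / (L * LL ^ 2) * (K * Real.exp 3) *
        ((Cσ * LL) * ((4 * LL) * (2 * L))) := by gcongr
    _ = _ := by field_simp; norm_num

end Total

/-! ### Quasi-independence and full measure on the circle. -/

section FullMeasure

variable {γ β γ' ρ c B ω κ κ' : ℝ} {Ψ : ℕ → ℝ} {e : ℕ → ℕ → ℝ}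

theorem exists_sum_excess_le (hρ : 0 < ρ) (hc : 0 < c) (hB : 1 ≤ B)
    (hdio : ∀ n m : ℤ, (n ≠ 0 ∨ m ≠ 0) →
      c * (max |(n : ℝ)| |(m : ℝ)|) ^ (-ρ) ≤ distInt (n * γ + m * β))
    (hκ : 0 < κ) (hκ1 : κ ≤ 1) (hκκ' : κ * (2 * ρ + 2) ≤ κ') (hκρ : 5 * κ' * ρ + 7 * κ' ≤ 1)
    (hω : 0 < ω) (hωκ : ω ≤ κ / 8) (hΨ : IsTruncated β γ' ω B Ψ) (he : IsExcess γ Ψ e)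
    {K : ℝ} (hK : 1 ≤ K) :
    ∃ C : ℝ, ∀ q, IsLarge c B κ κ' q → Ψ q ≠ 0 → ∀ T : Finset ℕ,
      (∀ r ∈ T, q < r ∧ r * Ψ q < K * q.gcd r) → ∑ r ∈ T, e q r ≤ C * Ψ q := by
  obtain ⟨Cσ, hCσ, hσ⟩ := sum_divisors_rpow_le_loglog
  obtain ⟨Cτ, hCτ, hτ⟩ := card_divisors_le_rpow (ε := κ / 8) (by positivity)
  refine ⟨2 * Cτ * (1 + 1 / ω) + 2 * Cτ * (4 / c) ^ (1 / ρ) +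
    885120 * Real.exp 3 * B * K * Cσ, fun q hq hq0 T hT => ?_⟩
  -- When Ψ(r) = 0 the right-hand excess bound is zero, so discarding such r does not decrease the
  -- sum.
  have h0 : ∑ r ∈ T, e q r ≤ ∑ r ∈ T.filter (fun r => Ψ r ≠ 0), e q r := by
    rw [Finset.sum_filter]
    refine Finset.sum_le_sum fun r hr => ?_
    split_ifs with h
    · exact le_rfl
    · have h1 := he.le_right q r hq.pos (by have := (hT r hr).1; omega)
      rw [not_not.1 h] at h1
      simpa using h1
  refine h0.trans ?_
  rw [← Finset.sum_filter_add_sum_filter_not (T.filter (fun r => Ψ r ≠ 0))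
    (fun r : ℕ => (q : ℝ) ^ (1 + κ) ≤ r),
    ← Finset.sum_filter_add_sum_filter_not ((T.filter (fun r => Ψ r ≠ 0)).filter
      (fun r : ℕ => ¬ (q : ℝ) ^ (1 + κ) ≤ r)) (fun r : ℕ => (q : ℝ) ^ κ' ≤ q.gcd r)]
  have hκκ : κ ≤ κ' := by nlinarith
  have h1 := sum_excess_far_le hκ hκ1 hω hωκ hCτ hτ hΨ he hq hq0
    ((T.filter (fun r => Ψ r ≠ 0)).filter (fun r : ℕ => (q : ℝ) ^ (1 + κ) ≤ r)) (by
      intro r hr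
      simp only [Finset.mem_filter] at hr
      exact ⟨(hT r hr.1.1).1, hr.2⟩)
  have h2 := sum_excess_large_gcd_le hρ hc hdio hκ hκ1 hκκ' hω hωκ hCτ hτ hΨ he hq
    (((T.filter (fun r => Ψ r ≠ 0)).filter (fun r : ℕ => ¬ (q : ℝ) ^ (1 + κ) ≤ r)).filter
      (fun r => (q : ℝ) ^ κ' ≤ q.gcd r)) (by
      intro r hr
      simp only [Finset.mem_filter] at hr
      exact ⟨(hT r hr.1.1.1).1, (not_le.1 hr.1.2).le, hr.2⟩)
  have h3 := sum_excess_small_gcd_le hρ hc hB hdio hκ hκ1 hκκ hκρ hω hωκ hK hCσ hσ hΨ he hq hq0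
    (((T.filter (fun r => Ψ r ≠ 0)).filter (fun r : ℕ => ¬ (q : ℝ) ^ (1 + κ) ≤ r)).filter
      (fun r => ¬ (q : ℝ) ^ κ' ≤ q.gcd r)) (by
      intro r hr
      simp only [Finset.mem_filter] at hr
      exact ⟨(hT r hr.1.1.1).1, (not_le.1 hr.1.2).le, (not_le.1 hr.2).le, hr.1.1.2,
        (hT r hr.1.1.1).2⟩)
  linarith

theorem sum_sum_range_of_symm {f : ℕ → ℕ → ℝ} (hf : ∀ m n, f m n = f n m) (N : ℕ) :
    ∑ m ∈ Finset.range N, ∑ n ∈ Finset.range N, f m n =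
      ∑ m ∈ Finset.range N, (f m m + 2 * ∑ n ∈ (Finset.range N).filter (m < ·), f m n) := by
  have h1 : ∀ m ∈ Finset.range N, ∑ n ∈ Finset.range N, f m n =
      f m m + ∑ n ∈ Finset.range N, (if m < n then f m n else 0) +
        ∑ n ∈ Finset.range N, (if n < m then f m n else 0) := by
    intro m hm
    have h2 : f m m = ∑ n ∈ Finset.range N, (if m = n then f m n else 0) := by
      rw [Finset.sum_ite_eq, if_pos hm]
    rw [h2, ← Finset.sum_add_distrib, ← Finset.sum_add_distrib]
    refine Finset.sum_congr rfl fun n _ => ?_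
    rcases lt_trichotomy m n with h | h | h
    · simp [h, h.ne, h.not_gt]
    · simp [h]
    · simp [h, h.ne', h.not_gt]
  rw [Finset.sum_congr rfl h1, Finset.sum_add_distrib]
  have h3 : ∑ m ∈ Finset.range N, ∑ n ∈ Finset.range N, (if n < m then f m n else 0) =
      ∑ m ∈ Finset.range N, ∑ n ∈ Finset.range N, (if m < n then f m n else 0) := by
    rw [Finset.sum_comm]
    refine Finset.sum_congr rfl fun m _ => Finset.sum_congr rfl fun n _ => ?_
    rw [hf n m]
  rw [h3, ← Finset.sum_add_distrib]
  refine Finset.sum_congr rfl fun m _ => ?_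
  rw [Finset.sum_filter]
  ring

/-- The overlap bound is used in both orders. Positive excess makes the intersection nonempty, and
eliminating a common point t gives the condition on γ. -/
theorem isExcess_approxSet (hΨ0 : ∀ q, 0 ≤ Ψ q) (hΨ1 : ∀ q, Ψ q ≤ 1 / 2) :
    IsExcess γ Ψ fun q r =>
      volume.real (approxSet γ q (Ψ q) ∩ approxSet γ r (Ψ r)) - 4 * Ψ q * Ψ r where
  le_left q r hq _ := by
    have := volume_real_approxSet_inter_le (γ : UnitAddCircle) (r := r) hq (hΨ0 q) (hΨ1 q) (hΨ0 r)
    linarith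
  le_right q r _ hr := by
    have := volume_real_approxSet_inter_le (γ : UnitAddCircle) (r := q) hr (hΨ0 r) (hΨ1 r) (hΨ0 q)
    rw [Set.inter_comm, Nat.gcd_comm] at this
    linarith
  near q r hq hqr h := by
    have h0 := mul_nonneg (mul_nonneg zero_le_four (hΨ0 q)) (hΨ0 r)
    have hne : (approxSet γ q (Ψ q) ∩ approxSet γ r (Ψ r)).Nonempty := by
      rw [Set.nonempty_iff_ne_empty]
      intro hemp
      rw [hemp, measureReal_empty] at h
      linarith
    obtain ⟨t, h1, h2⟩ := hne
    have hd : 0 < q.gcd r := Nat.gcd_pos_of_pos_left r hq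
    have hdq := Nat.gcd_dvd_left q r
    have hdr := Nat.gcd_dvd_right q r
    have hdR : ((q.gcd r : ℕ) : ℝ) ≠ 0 := by exact_mod_cast hd.ne'
    have hr : q / q.gcd r + (r - q) / q.gcd r = r / q.gcd r := by
      rw [← Nat.add_div_of_dvd_right hdq, Nat.add_sub_cancel' hqr.le]
    have e1 : q.gcd r * (q / q.gcd r) = q := Nat.mul_div_cancel' hdq
    have e2 : q.gcd r * (q / q.gcd r + (r - q) / q.gcd r) = r := by
      rw [hr]; exact Nat.mul_div_cancel' hdr
    have h3 := norm_nsmul_lt_of_mem_inter (γ := (γ : UnitAddCircle)) (d := q.gcd r)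
      (q' := q / q.gcd r) (n := (r - q) / q.gcd r) (u := Ψ q) (v := Ψ r) (t := t)
      (Nat.div_pos (Nat.le_of_dvd hq hdq) hd) (by rw [e1]; exact h1) (by rw [e2]; exact h2)
    rw [hr, Nat.cast_div hdr hdR, Nat.cast_div hdq hdR] at h3
    rw [distInt_eq_norm, ← nsmul_eq_mul, AddCircle.coe_nsmul]
    exact h3

theorem IsTruncated.le_half (hω : ω ≤ 1 / 2) (hΨ : IsTruncated β γ' ω B Ψ)
    (hlarge : ∀ q, Ψ q ≠ 0 → IsLarge c B κ κ' q) (q : ℕ) : Ψ q ≤ 1 / 2 := by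
  by_cases h0 : Ψ q = 0
  · rw [h0]; norm_num
  have hq := hlarge q h0
  have hqR0 : (0 : ℝ) < q := by linarith [hq.one_lt]
  have h4 : (4 : ℝ) ≤ q := by
    have h1 := hq.four_le_log
    have := Real.log_le_sub_one_of_pos hqR0
    linarith
  calc Ψ q ≤ (q : ℝ) ^ (-1 + ω) := hΨ.le_rpow hq le_rfl
    _ ≤ (q : ℝ) ^ (-(1 / 2) : ℝ) :=
      Real.rpow_le_rpow_of_exponent_le hq.one_lt.le (by linarith)
    _ ≤ (4 : ℝ) ^ (-(1 / 2) : ℝ) := Real.rpow_le_rpow_of_nonpos (by norm_num) h4 (by norm_num)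
    _ = 1 / 2 := by
      rw [show (4 : ℝ) = 2 ^ (2 : ℝ) by norm_num, ← Real.rpow_mul (by norm_num)]
      norm_num

/-- Full measure for a truncated approximation function with divergent sum. -/
theorem ae_frequently_of_isTruncated (hρ : 0 < ρ) (hc : 0 < c) (hB : 1 ≤ B)
    (hdio : ∀ n m : ℤ, (n ≠ 0 ∨ m ≠ 0) →
      c * (max |(n : ℝ)| |(m : ℝ)|) ^ (-ρ) ≤ distInt (n * γ + m * β))
    (hκ : 0 < κ) (hκ1 : κ ≤ 1) (hκκ' : κ * (2 * ρ + 2) ≤ κ') (hκρ : 5 * κ' * ρ + 7 * κ' ≤ 1)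
    (hω : 0 < ω) (hωκ : ω ≤ κ / 8) (hΨ : IsTruncated β γ' ω B Ψ)
    (hlarge : ∀ q, Ψ q ≠ 0 → IsLarge c B κ κ' q) (hdiv : ¬ Summable Ψ) :
    ∀ᵐ t : UnitAddCircle, ∃ᶠ q in atTop, t ∈ approxSet γ q (Ψ q) := by
  have hΨ0 := hΨ.nonneg
  have hΨ1 := hΨ.le_half (by linarith) hlarge
  have hzero : ∀ q, Ψ q = 0 → approxSet (γ : UnitAddCircle) q (Ψ q) = ∅ := by
    intro q h
    ext t
    simp [approxSet, h]
  have hvol : ∀ q, volume.real (approxSet (γ : UnitAddCircle) q (Ψ q)) = 2 * Ψ q := by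
    intro q
    by_cases h : Ψ q = 0
    · rw [hzero q h, h]; simp
    · exact volume_real_approxSet _ (hlarge q h).pos.ne' (hΨ0 q) (hΨ1 q)
  have he := isExcess_approxSet (γ := γ) hΨ0 hΨ1
  set e : ℕ → ℕ → ℝ := fun q r =>
      volume.real (approxSet (γ : UnitAddCircle) q (Ψ q) ∩ approxSet γ r (Ψ r)) - 4 * Ψ q * Ψ r
    with hedef
  have hsymm : ∀ m n, e m n = e n m := by
    intro m n
    simp only [hedef]
    rw [Set.inter_comm]; ring
  have : IsProbabilityMeasure (volume : Measure UnitAddCircle) := ⟨UnitAddCircle.measure_univ⟩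
  refine ae_frequently_mem_of_pairwise volume _ (fun q => measurableSet_approxSet _ _ _) ?_ ?_
  · simp_rw [hvol]
    have h1 := (not_summable_iff_tendsto_nat_atTop_of_nonneg hΨ0).1 hdiv
    simp_rw [← Finset.mul_sum]
    exact h1.const_mul_atTop two_pos
  · intro ε hε
    set K := max 1 (1 / ε) with hK
    have hK1 : 1 ≤ K := le_max_left _ _
    have hKε : 1 / K ≤ ε := by
      rw [div_le_iff₀ (by positivity)]
      have : 1 / ε ≤ K := le_max_right _ _
      rw [div_le_iff₀ hε] at this
      linarith
    obtain ⟨C, hC⟩ := exists_sum_excess_le hρ hc hB hdio hκ hκ1 hκκ' hκρ hω hωκ hΨ he hK1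
    refine ⟨1 + C, fun N => ?_⟩
    simp_rw [hvol]
    have h1 : ∀ m n, volume.real (approxSet (γ : UnitAddCircle) m (Ψ m) ∩ approxSet γ n (Ψ n)) -
        2 * Ψ m * (2 * Ψ n) = e m n := by
      intro m n; simp only [hedef]; ring
    simp_rw [h1]
    rw [sum_sum_range_of_symm hsymm]
    set S := ∑ n ∈ Finset.range N, Ψ n with hS
    have hS0 : 0 ≤ S := Finset.sum_nonneg fun n _ => hΨ0 n
    have h2 : ∀ m ∈ Finset.range N,
        e m m + 2 * ∑ n ∈ (Finset.range N).filter (m < ·), e m n ≤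
          2 * Ψ m + 2 * (C * Ψ m + 2 / K * Ψ m * S) := by
      intro m _
      by_cases hm : Ψ m = 0
      · have h3 : ∀ n, e m n = 0 := by
          intro n; simp only [hedef]; rw [hzero m hm, hm]; simp
        simp [h3, hm]
      have hlm := hlarge m hm
      have hdiag : e m m ≤ 2 * Ψ m := by
        simp only [hedef, Set.inter_self, hvol]
        nlinarith [hΨ0 m]
      have hoff : ∑ n ∈ (Finset.range N).filter (m < ·), e m n ≤ C * Ψ m + 2 / K * Ψ m * S := by
        -- Where the condition fails, gcd(m,n)/n ≤ Ψ(m)/K, so the excess is at most (2/K)Ψ(m)Ψ(n).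
        -- These terms give the quadratic part, which 1/K ≤ ε controls; the others give the linear
        -- part.
        rw [← Finset.sum_filter_add_sum_filter_not _ (fun n : ℕ => n * Ψ m < K * m.gcd n)]
        refine add_le_add ?_ ?_
        · refine hC m hlm hm _ fun n hn => ?_
          simp only [Finset.mem_filter] at hn
          exact ⟨hn.1.2, hn.2⟩
        · rw [hS, Finset.mul_sum]
          refine le_trans (Finset.sum_le_sum fun n hn => ?_)
            (Finset.sum_le_sum_of_subset_of_nonneg
              ((Finset.filter_subset _ _).trans (Finset.filter_subset _ _)) fun n _ _ => ?_)
          · simp only [Finset.mem_filter, not_lt] at hn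
            have hn0 : 0 < n := by omega
            have hnR : (0 : ℝ) < n := by exact_mod_cast hn0
            refine (he.le_right m n hlm.pos hn0).trans ?_
            have h4 : (m.gcd n : ℝ) / n ≤ Ψ m / K := by
              rw [div_le_div_iff₀ hnR (by positivity)]
              linarith [hn.2]
            have h5 := hΨ0 n
            calc 2 * (m.gcd n : ℝ) * Ψ n / n = 2 * ((m.gcd n : ℝ) / n) * Ψ n := by ring
              _ ≤ 2 * (Ψ m / K) * Ψ n := by gcongr
              _ = _ := by ring
          · have := hΨ0 m
            have := hΨ0 n
            positivity
      linarith
    refine (Finset.sum_le_sum h2).trans ?_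
    have h3 : ∑ m ∈ Finset.range N, (2 * Ψ m + 2 * (C * Ψ m + 2 / K * Ψ m * S)) =
        2 * S + 2 * (C * S) + 1 / K * (2 * S) ^ 2 := by
      have h4 : ∀ m, 2 * Ψ m + 2 * (C * Ψ m + 2 / K * Ψ m * S) =
          (2 + 2 * C + 4 / K * S) * Ψ m := by intro m; ring
      simp_rw [h4]
      rw [← Finset.mul_sum, ← hS]; ring
    rw [h3, ← Finset.mul_sum, ← hS]
    have h5 : 1 / K * (2 * S) ^ 2 ≤ ε * (2 * S) ^ 2 := by gcongr
    linarith

end FullMeasure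

/-! ### Truncation, transfer to the interval and choice of parameters. -/

/-- Cauchy condensation reduces this to a sum of inverse cubes. The 1 added to the logarithm avoids
its zero at q = 1 and makes the terms decreasing on all positive integers. -/
theorem summable_one_div_mul_log_pow :
    Summable fun q : ℕ => 1 / ((q : ℝ) * (1 + Real.log q) ^ 3) := by
  rw [← summable_condensed_iff_of_nonneg]
  · have h1 : Summable fun k : ℕ => 1 / (Real.log 2) ^ 3 * (1 / ((k + 1 : ℕ) : ℝ) ^ 3) :=
      (((summable_nat_add_iff 1).2 (Real.summable_one_div_nat_pow.2 (by norm_num :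
        1 < 3))).mul_left _)
    have hl : 0 < Real.log 2 := Real.log_pos one_lt_two
    have hl1 : Real.log 2 ≤ 1 := by linarith [Real.log_two_lt_d9]
    refine Summable.of_nonneg_of_le (fun k => ?_) (fun k => ?_) h1
    · have : 0 ≤ Real.log ((2 ^ k : ℕ) : ℝ) := Real.log_natCast_nonneg _
      positivity
    · push_cast
      rw [Real.log_pow]
      have h2 : Real.log 2 * (k + 1) ≤ 1 + k * Real.log 2 := by linarith
      calc (2 : ℝ) ^ k * (1 / (2 ^ k * (1 + k * Real.log 2) ^ 3))
          = 1 / (1 + k * Real.log 2) ^ 3 := by field_simp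
        _ ≤ 1 / (Real.log 2 * (k + 1)) ^ 3 := by gcongr
        _ = _ := by rw [mul_pow]; field_simp
  · intro n
    have := Real.log_natCast_nonneg n
    positivity
  · intro m n hm hmn
    have hm' : (0 : ℝ) < m := by exact_mod_cast hm
    have h1 : Real.log m ≤ Real.log n := Real.log_le_log hm' (by exact_mod_cast hmn)
    have := Real.log_natCast_nonneg m
    gcongr

theorem eventually_isLarge (c B : ℝ) {κ κ' : ℝ} (hκ : 0 < κ) (hκ' : 0 < κ') :
    ∀ᶠ q : ℕ in atTop, IsLarge c B κ κ' q := by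
  have hlog : Tendsto (fun q : ℕ => Real.log q) atTop atTop :=
    Real.tendsto_log_atTop.comp tendsto_natCast_atTop_atTop
  have h1 := (Real.tendsto_log_atTop.comp hlog).eventually_ge_atTop 3
  have h2 := hlog.eventually_ge_atTop B
  have h3 := ((tendsto_rpow_atTop hκ').comp tendsto_natCast_atTop_atTop).eventually_ge_atTop (8 / c)
  have h4 := ((isLittleO_log_rpow_rpow_atTop 3 (show 0 < κ / 8 by positivity)).bound
    zero_lt_one)
  have h5 := tendsto_natCast_atTop_atTop (R := ℝ) |>.eventually h4
  filter_upwards [h1, h2, h3, h5] with q a1 a2 a3 a4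
  refine ⟨a1, ?_, a3, a2⟩
  have h6 : (0 : ℝ) ≤ (q : ℝ) ^ (κ / 8) := by positivity
  rw [one_mul, Real.norm_of_nonneg h6] at a4
  have h7 := (le_abs_self _).trans a4
  rw [show (3 : ℝ) = (3 : ℕ) by norm_num, Real.rpow_natCast] at h7
  exact h7

theorem volume_fibredSet_eq_one_of_ae {ψ : ℕ → ℝ} {γ β γ' : ℝ}
    (h : ∀ᵐ t : UnitAddCircle, ∃ᶠ q : ℕ in atTop,
      ‖q • t - (γ : UnitAddCircle)‖ * distInt (q * β - γ') < ψ q) :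
    volume (fibredSet ψ β γ γ') = 1 := by
  have h1 := (UnitAddCircle.measurePreserving_mk 0).quasiMeasurePreserving.ae h
  rw [zero_add] at h1
  apply le_antisymm
  · calc volume (fibredSet ψ β γ γ') ≤ volume (Set.Icc (0 : ℝ) 1) :=
          measure_mono fun x hx => hx.1
      _ = 1 := by simp
  · calc (1 : ENNReal) = volume (Set.Ioc (0 : ℝ) 1) := by simp
      _ ≤ volume (fibredSet ψ β γ γ') := by
        refine measure_mono_ae ?_
        have h2 := (ae_restrict_iff' measurableSet_Ioc).1 h1
        filter_upwards [h2] with x hx hmem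
        refine ⟨Set.Ioc_subset_Icc_self hmem, (hx hmem).mono fun q hq => ?_⟩
        rw [distInt_eq_norm (q * x - γ), AddCircle.coe_sub, ← nsmul_eq_mul, AddCircle.coe_nsmul]
        exact hq

/-- Divergence survives the truncation. -/
theorem exists_isTruncated {β γ' ω c κ κ' : ℝ} (hκ : 0 < κ) (hκ' : 0 < κ') {ψ : ℕ → ℝ}
    (hψ : ∀ q : ℕ, 1 ≤ q → 0 ≤ ψ q)
    (hO : ψ =O[atTop] fun q : ℕ => ((q : ℝ) * Real.log q * (Real.log (Real.log q)) ^ 2)⁻¹)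
    (hdiv : ¬ Summable (fun q : admissible β γ' ω => ψ q / distInt ((q : ℕ) * β - γ'))) :
    ∃ (B : ℝ) (Ψ : ℕ → ℝ), 1 ≤ B ∧ IsTruncated β γ' ω B Ψ ∧
      (∀ q, Ψ q ≠ 0 → IsLarge c B κ κ' q ∧ Ψ q = ψ q / distInt (q * β - γ')) ∧ ¬ Summable Ψ := by
  classical
  obtain ⟨B₀, hB₀⟩ := hO.bound
  set B := max 1 B₀ with hB
  have hB1 : 1 ≤ B := le_max_left _ _
  obtain ⟨q₀, hq₀⟩ := eventually_atTop.1 (hB₀.and (eventually_isLarge c B hκ hκ'))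
  set D : ℕ → ℝ := fun q => distInt (q * β - γ') with hD
  have hD0 : ∀ q, 0 ≤ D q := fun q => distInt_nonneg _
  -- The last condition supplies the lower bound on Ψ. The terms it discards are below 1/(q log³ q),
  -- hence summable, so divergence is unaffected.
  set p : ℕ → Prop := fun q => q₀ ≤ q ∧ (q : ℝ) ^ (-ω) ≤ D q ∧
    1 ≤ ψ q / D q * (q * Real.log q ^ 3) with hp
  set Ψ : ℕ → ℝ := fun q => if p q then ψ q / D q else 0 with hΨ
  have hval : ∀ q, Ψ q ≠ 0 → p q ∧ Ψ q = ψ q / D q := by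
    intro q h
    by_cases hpq : p q
    · exact ⟨hpq, if_pos hpq⟩
    · exact absurd (if_neg hpq) h
  refine ⟨B, Ψ, hB1, ⟨?_, ?_, ?_, ?_⟩, ?_, ?_⟩
  · intro q
    simp only [hΨ]
    split_ifs with h
    · exact div_nonneg (hψ q (hq₀ q h.1).2.pos) (hD0 q)
    · exact le_rfl
  · intro q h
    exact (hval q h).1.2.1
  · intro q h
    obtain ⟨⟨h1, h2, h3⟩, h4⟩ := hval q h
    obtain ⟨h5, h6⟩ := hq₀ q h1
    have hqR0 : (0 : ℝ) < q := by exact_mod_cast h6.pos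
    have hDpos : 0 < D q := lt_of_lt_of_le (by positivity) h2
    have hW := h6.weight_pos
    rw [h4, div_mul_cancel₀ _ hDpos.ne']
    have h7 : 0 < (q : ℝ) * Real.log q * (Real.log (Real.log q)) ^ 2 := by
      rw [mul_assoc]; positivity
    rw [Real.norm_of_nonneg (hψ q h6.pos), Real.norm_of_nonneg (inv_nonneg.2 h7.le),
      ← div_eq_mul_inv, le_div_iff₀ h7] at h5
    rw [← mul_assoc (q : ℝ)]
    exact h5.trans (le_max_right _ _)
  · intro q h
    obtain ⟨⟨h1, h2, h3⟩, h4⟩ := hval q h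
    rw [h4]; exact h3
  · intro q h
    obtain ⟨⟨h1, h2, h3⟩, h4⟩ := hval q h
    exact ⟨(hq₀ q h1).2, h4⟩
  · intro hsum
    apply hdiv
    have h1 : (fun q : admissible β γ' ω => ψ q / distInt ((q : ℕ) * β - γ')) =
        (fun q : ℕ => ψ q / D q) ∘ Subtype.val := rfl
    rw [h1, summable_subtype_iff_indicator, ← summable_nat_add_iff (q₀ + 1)]
    have hs := ((summable_nat_add_iff (q₀ + 1)).2
      (hsum.add (summable_one_div_mul_log_pow.mul_left 8)))
    refine Summable.of_nonneg_of_le (fun n => ?_) (fun n => ?_) hs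
    · refine Set.indicator_nonneg (fun q hq => ?_) _
      exact div_nonneg (hψ q hq.1) (hD0 q)
    · set q := n + (q₀ + 1) with hq
      have hlarge := (hq₀ q (by omega)).2
      have hqR0 : (0 : ℝ) < q := by exact_mod_cast hlarge.pos
      have hlog := hlarge.four_le_log
      have hΨq : 0 ≤ Ψ q := by
        simp only [hΨ]
        split_ifs
        · exact div_nonneg (hψ q hlarge.pos) (hD0 q)
        · exact le_rfl
      have hpos : 0 ≤ 8 * (1 / ((q : ℝ) * (1 + Real.log q) ^ 3)) := by positivity
      by_cases hadm : q ∈ admissible β γ' ω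
      · rw [Set.indicator_of_mem hadm]
        by_cases hpq : p q
        · have : Ψ q = ψ q / D q := if_pos hpq
          linarith
        · have h2 : ψ q / D q * (q * Real.log q ^ 3) < 1 := by
            by_contra hcon
            exact hpq ⟨by omega, hadm.2.1, not_lt.1 hcon⟩
          have h3 : ψ q / D q ≤ 1 / (q * Real.log q ^ 3) := by
            rw [le_div_iff₀ (by positivity)]; exact h2.le
          have h4 : 1 / (q * Real.log q ^ 3) ≤ 8 * (1 / ((q : ℝ) * (1 + Real.log q) ^ 3)) := by
            rw [mul_one_div, div_le_div_iff₀ (by positivity) (by positivity)]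
            have h5 : (1 + Real.log q) ^ 3 ≤ (2 * Real.log q) ^ 3 := by gcongr; linarith
            calc 1 * ((q : ℝ) * (1 + Real.log q) ^ 3) ≤ q * (2 * Real.log q) ^ 3 := by
                  rw [one_mul]; gcongr
              _ = _ := by ring
          linarith
      · rw [Set.indicator_of_notMem hadm]
        linarith

/-- Since the terms `ψ(q) / ‖q β - γ'‖` are nonnegative, divergence of their sum is the failure of
`Summable`. The bound `ω₀` is chosen before `γ'` and `ψ`. -/
theorem theorem1p1 (γ β : ℝ) (hγ : Irrational γ) (hβ : Irrational β)
    (hγβ : IsDiophantinePair γ β) :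
    ∃ ω₀ : ℝ, 0 < ω₀ ∧ ∀ ω : ℝ, 0 < ω → ω < ω₀ →
      ∀ (γ' : ℝ) (ψ : ℕ → ℝ), (∀ q : ℕ, 1 ≤ q → 0 ≤ ψ q) →
        (ψ =O[atTop] fun q : ℕ =>
          ((q : ℝ) * Real.log q * (Real.log (Real.log q)) ^ 2)⁻¹) →
        ¬ Summable (fun q : admissible β γ' ω => ψ q / distInt ((q : ℕ) * β - γ')) →
        volume (fibredSet ψ β γ γ') = 1 := by
  obtain ⟨-, ρ, c, hρ, hc, hdio⟩ := hγβ
  -- Both parameter constraints hold with equality: 5κ'ρ + 7κ' = 1 and κ(2ρ+2) = κ'. Hence ω₀ = κ/8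
  -- depends on ρ alone.
  set κ' : ℝ := 1 / (5 * ρ + 7) with hκ'
  set κ : ℝ := κ' / (2 * ρ + 2) with hκ
  have hκ'0 : 0 < κ' := by positivity
  have hκ0 : 0 < κ := by positivity
  have hκκ' : κ * (2 * ρ + 2) ≤ κ' := (div_mul_cancel₀ _ (by positivity)).le
  have hκρ : 5 * κ' * ρ + 7 * κ' ≤ 1 := by
    rw [hκ']; apply le_of_eq; field_simp
  have hκ1 : κ ≤ 1 := by nlinarith [mul_pos hκ0 hρ, mul_pos hκ'0 hρ]
  refine ⟨κ / 8, by positivity, fun ω hω hωκ γ' ψ hψ hO hdiv => ?_⟩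
  obtain ⟨B, Ψ, hB, hΨ, hval, hdiv'⟩ :=
    exists_isTruncated (c := c) hκ0 hκ'0 hψ hO hdiv
  have hae := ae_frequently_of_isTruncated hρ hc hB hdio hκ0 hκ1 hκκ' hκρ hω hωκ.le hΨ
    (fun q hq => (hval q hq).1) hdiv'
  refine volume_fibredSet_eq_one_of_ae ?_
  filter_upwards [hae] with t ht
  refine ht.mono fun q hq => ?_
  change ‖q • t - (γ : UnitAddCircle)‖ < Ψ q at hq
  have hne : Ψ q ≠ 0 := by
    intro h
    rw [h] at hq
    exact absurd hq (norm_nonneg _).not_gt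
  obtain ⟨hlarge, hΨq⟩ := hval q hne
  have hD : 0 < distInt (q * β - γ') := by
    have hq0 : (0 : ℝ) < q := by exact_mod_cast hlarge.pos
    exact lt_of_lt_of_le (by positivity) (hΨ.rpow_le q hne)
  rw [hΨq, lt_div_iff₀ hD] at hq
  exact hq
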